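/- For a sequence $(u_n)_{n\ge 1}$ in $[0,1)$ and $N\in\mathbb N$ let $$D_N=\sup_{0\le a<b\le 1}\bigl|\#\{1\le n\le N:\ u_n\in(a,b)\}-(b-a)N\bigr|$$ denote its (unnormalised) discrepancy at length $N$. For an integer $d\ge 2$ and $x\in[0,1)$ let $\Delta_d(x;N)$ be the discrepancy at length $N$ of the sequence of fractional parts $\{xn^d\}$, $n\in\mathbb N$, and for $0<\alpha<1$ set $$\mathscr D_{\alpha,d}=\{x\in[0,1):\ \Delta_d(x;N)\ge N^{\alpha}\ \text{for infinitely many } N\in\mathbb N\}.$$ Let $\dim$ denote Hausdorff dimension in $\mathbb R$. Then for each $0<\alpha<1$: (i) for $d=2$, $$\dim\mathscr D_{\alpha,2}\ \ge\ \min\left\{\frac45,\ \frac{4(1-\alpha)}{3-\alpha}\right\};$$ (ii) for every integer $d\ge 3$, $$\dim\mathscr D_{\alpha,d}\ \ge\ \min\left\{\frac{d+1}{d^2+1},\ \frac{(d+1)(1-\alpha)}{d+1-\alpha}\right\}.$$ -/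

import Mathlib

open Set

noncomputable section

/-- The counting error `|#{1 ≤ n ≤ N : u n ∈ (a, b)} - (b - a) N|` of the sequence `u`
on the open interval `(a, b)`. -/
def countingError (u : ℕ → ℝ) (N : ℕ) (a b : ℝ) : ℝ :=
  |(({n : ℕ | 1 ≤ n ∧ n ≤ N ∧ u n ∈ Ioo a b}.ncard : ℕ) : ℝ) - (b - a) * (N : ℝ)|

/-- The (unnormalised) discrepancy at length `N` of a sequence `u 1, u 2, …` in `[0, 1)`:
`D_N = sup_{0 ≤ a < b ≤ 1} |#{1 ≤ n ≤ N : u n ∈ (a, b)} - (b - a) N|`. -/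
def discrepancy (u : ℕ → ℝ) (N : ℕ) : ℝ :=
  sSup {y : ℝ | ∃ a b : ℝ, 0 ≤ a ∧ a < b ∧ b ≤ 1 ∧ y = countingError u N a b}

/-- The supremum defining the discrepancy is over a bounded set, so it is a true supremum. -/
theorem bddAbove_countingError (u : ℕ → ℝ) (N : ℕ) :
    BddAbove {y : ℝ | ∃ a b : ℝ, 0 ≤ a ∧ a < b ∧ b ≤ 1 ∧ y = countingError u N a b} := by
  refine ⟨(N : ℝ), ?_⟩
  rintro y ⟨a, b, ha, hab, hb, rfl⟩
  have hc : {n : ℕ | 1 ≤ n ∧ n ≤ N ∧ u n ∈ Ioo a b}.ncard ≤ N := by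
    have hsub : {n : ℕ | 1 ≤ n ∧ n ≤ N ∧ u n ∈ Ioo a b} ⊆ (Finset.Icc 1 N : Finset ℕ) := by
      rintro n ⟨h1, h2, -⟩
      simp [h1, h2]
    simpa [Set.ncard_coe_finset] using Set.ncard_le_ncard hsub (Finset.finite_toSet _)
  have hc' : (({n : ℕ | 1 ≤ n ∧ n ≤ N ∧ u n ∈ Ioo a b}.ncard : ℕ) : ℝ) ≤ N := by
    exact_mod_cast hc
  have hc0 : (0 : ℝ) ≤ (({n : ℕ | 1 ≤ n ∧ n ≤ N ∧ u n ∈ Ioo a b}.ncard : ℕ) : ℝ) :=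
    Nat.cast_nonneg _
  have hN : (0 : ℝ) ≤ N := Nat.cast_nonneg _
  unfold countingError
  rw [abs_le]
  constructor <;> nlinarith

/-- `Δ_d(x; N)`: the discrepancy at length `N` of the sequence `x n ^ d` modulo one. -/
def monomialDiscrepancy (d : ℕ) (x : ℝ) (N : ℕ) : ℝ :=
  discrepancy (fun n : ℕ => Int.fract (x * (n : ℝ) ^ d)) N

/-- The set of `x ∈ [0, 1)` with `Δ_d(x; N) ≥ N ^ α` for infinitely many `N`. -/
def largeDiscrepancySet (α : ℝ) (d : ℕ) : Set ℝ :=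
  {x : ℝ | x ∈ Ico (0 : ℝ) 1 ∧ {N : ℕ | (N : ℝ) ^ α ≤ monomialDiscrepancy d x N}.Infinite}

end

/-! The discrepancy is large near rationals with special denominators, and the points that are
infinitely often that close to such rationals form a set whose dimension has a Jarník-type lower
bound.

Near rationals. For `d = 2`, if `x` is near `a / p` and `N` is a multiple of `p`, the Weyl sum has
size about `N / √p` by the Gauss sum; Koksma's inequality turns this into discrepancy. This beats `N
^ α` once `N ^ (1 - α)` exceeds a multiple of `√p`, and it survives a displacement of `x` up to
about `N ^ (α - 3)`, so an exponent `τ > (3 - α) / (2 * (1 - α))` in `p ^ (-τ)` is enough. For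
general `d`, if `x` is just to the right of `a / p ^ d`, every multiple `n` of `p` up to `N` puts `x
* n ^ d` just above an integer. Too many fractional parts then lie in a short interval at `0`, as
soon as `N ^ (1 - α)` is about `8 * p` and `τ > (d + 1 - α) / (1 - α)`. These are
`exists_large_sq_discrepancy` and `exists_large_pow_discrepancy`.

Dimension. About `P ^ (e + 1)` fractions `a / p ^ e` have a prime `p` of size `P`, which suggests
dimension `(e + 1) / τ`: `2 / τ` for squares, `(d + 1) / τ` in general.
`le_dimH_of_near_primePow_fractions` proves this lower bound under a spacing condition on `s`. No
Cantor measure is built. `hausdorffMeasure_ne_zero_of_spread` assumes a cheap cover and descends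
through nested intervals on which the cover remains cheap relative to their length. The limit point
lies in the set, but a covering interval containing it would need zero length.

For `α` below the threshold `1 / 2` (squares) or `1 - 1 / d`, the set contains the one at the
threshold, which gives the constant term of the minimum. -/

/-! ### Part: Hausdorff measure and descent through nested intervals. -/

/-- A set of zero `s`-dimensional Hausdorff measure is covered by countably many nondegenerate
closed intervals whose lengths have an arbitrarily small sum of `s`-th powers. -/
theorem exists_interval_cover_of_hausdorffMeasure_eq_zero {E : Set ℝ} {s : ℝ} (hs : 0 < s)
    (hE : MeasureTheory.Measure.hausdorffMeasure s E = 0) {η : ℝ} (hη : 0 < η) :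
    ∃ a u : ℕ → ℝ, E ⊆ ⋃ n, Icc (a n) (a n + u n) ∧ (∀ n, 0 < u n) ∧
      Summable (fun n => u n ^ s) ∧ ∑' n, u n ^ s ≤ η := by
  classical
  -- The factor `2` pays for padding the pieces, and `2 ^ s` for replacing a set by an interval of
  -- twice its padded diameter centred at one of its points.
  set η' : ℝ := η / 2 / 2 ^ s with hη'
  have h2s : (0 : ℝ) < 2 ^ s := by positivity
  have hη'0 : 0 < η' := by positivity
  rw [MeasureTheory.Measure.hausdorffMeasure_apply] at hE
  have h1 := (iSup₂_le_iff.mp hE.le) 1 one_pos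
  have h2 : (⨅ (t : ℕ → Set ℝ) (_ : E ⊆ ⋃ n, t n) (_ : ∀ n, Metric.ediam (t n) ≤ 1),
      ∑' n, ⨆ _ : (t n).Nonempty, Metric.ediam (t n) ^ s) < ENNReal.ofReal η' :=
    lt_of_le_of_lt h1 (by simpa using hη'0)
  simp only [iInf_lt_iff] at h2
  obtain ⟨t, htE, htd, ht⟩ := h2
  set v : ℕ → ENNReal := fun n => ⨆ _ : (t n).Nonempty, Metric.ediam (t n) ^ s with hv
  have hvtop : ∑' n, v n ≠ ⊤ := (lt_of_lt_of_le ht le_top).ne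
  have hvs : Summable (fun n => (v n).toReal) := ENNReal.summable_toReal hvtop
  have hvn : ∀ n, v n ≠ ⊤ := ENNReal.ne_top_of_tsum_ne_top hvtop
  have hvsum : ∑' n, (v n).toReal ≤ η' := by
    rw [← ENNReal.tsum_toReal_eq hvn]
    exact ENNReal.toReal_le_of_le_ofReal hη'0.le ht.le
  have hgeo : HasSum (fun n : ℕ => η' / 2 / 2 ^ n) η' := hasSum_geometric_two' η'
  -- The geometric padding keeps lengths positive even for empty or one-point pieces.
  set w : ℕ → ℝ := fun n => (v n).toReal + η' / 2 / 2 ^ n with hw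
  have hw0 : ∀ n, 0 < w n := fun n => by
    have : 0 ≤ (v n).toReal := ENNReal.toReal_nonneg
    have : 0 < η' / 2 / 2 ^ n := by positivity
    simp only [hw]; linarith
  have hws : Summable w := hvs.add hgeo.summable
  have hwsum : ∑' n, w n ≤ 2 * η' := by
    rw [hw, Summable.tsum_add hvs hgeo.summable, hgeo.tsum_eq]; linarith
  have hpow : ∀ n, (2 * w n ^ (1 / s)) ^ s = 2 ^ s * w n := fun n => by
    rw [Real.mul_rpow (by norm_num) (Real.rpow_nonneg (hw0 n).le _), ← Real.rpow_mul (hw0 n).le,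
      one_div_mul_cancel hs.ne', Real.rpow_one]
  refine ⟨fun n => (if h : (t n).Nonempty then h.some else 0) - w n ^ (1 / s),
    fun n => 2 * w n ^ (1 / s), ?_, fun n => ?_, ?_, ?_⟩
  · intro x hx
    obtain ⟨n, hn⟩ := mem_iUnion.mp (htE hx)
    refine mem_iUnion.mpr ⟨n, ?_⟩
    have hne : (t n).Nonempty := ⟨x, hn⟩
    have hd : |x - hne.some| ≤ w n ^ (1 / s) := by
      have h3 : edist x hne.some ≤ Metric.ediam (t n) := Metric.edist_le_ediam_of_mem hn hne.some_mem
      have h4 : edist x hne.some ^ s ≤ v n := by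
        simp only [hv]
        rw [ciSup_pos hne]
        exact ENNReal.rpow_le_rpow h3 hs.le
      have h5 : |x - hne.some| ^ s ≤ (v n).toReal := by
        have := ENNReal.toReal_mono (hvn n) h4
        rwa [← ENNReal.toReal_rpow, edist_dist, ENNReal.toReal_ofReal dist_nonneg,
          Real.dist_eq] at this
      have h6 : |x - hne.some| ^ s ≤ w n := h5.trans (by
        have : 0 < η' / 2 / 2 ^ n := by positivity
        simp only [hw]; linarith)
      calc |x - hne.some| = (|x - hne.some| ^ s) ^ (1 / s) := by
            rw [← Real.rpow_mul (abs_nonneg _), mul_one_div_cancel hs.ne', Real.rpow_one]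
        _ ≤ _ := Real.rpow_le_rpow (by positivity) h6 (by positivity)
    rw [abs_le] at hd
    simp only [hne, dite_true]
    constructor <;> linarith [hd.1, hd.2]
  · have := Real.rpow_pos_of_pos (hw0 n) (1 / s)
    positivity
  · simp only [hpow]; exact hws.mul_left _
  · simp only [hpow]
    rw [tsum_mul_left]
    calc 2 ^ s * ∑' n, w n ≤ 2 ^ s * (2 * η') := by gcongr
      _ = η := by rw [hη']; field_simp

open Classical in
/-- The total `s`-dimensional cost of those intervals `[a n, a n + u n]` that meet
`[A, A + L]`. -/
noncomputable def meetingCost (a u : ℕ → ℝ) (s A L : ℝ) : ℝ :=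
  ∑' n, if (Icc A (A + L) ∩ Icc (a n) (a n + u n)).Nonempty then u n ^ s else 0

theorem summable_ite_of_nonneg {w : ℕ → ℝ} (hw : ∀ n, 0 ≤ w n) (hs : Summable w)
    (p : ℕ → Prop) [DecidablePred p] : Summable fun n => if p n then w n else 0 :=
  Summable.of_nonneg_of_le (fun n => by split_ifs <;> simp [hw])
    (fun n => by split_ifs <;> simp [hw]) hs

open Classical in
/-- One step of the construction: if the cover is cheap on `[A, A + L]` then it is cheap on one of
the children `[c, c + δ]`. -/
theorem exists_child_meetingCost_le {a u : ℕ → ℝ} {s K ε A L δ : ℝ}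
    (hu : ∀ n, 0 < u n) (hus : Summable fun n => u n ^ s) (hK : 0 < K) (hε : ε = 1 / (8 * K))
    (hL : 0 < L) (hδ : 0 < δ) (C : Finset ℝ)
    (hC : ∀ c ∈ C, A ≤ c ∧ c + δ ≤ A + L)
    (hcount : ∀ t v : ℝ, 0 < v → ((C.filter fun c =>
      (Icc c (c + δ) ∩ Icc t (t + v)).Nonempty).card : ℝ) ≤ 1 + K * C.card * (v / L) ^ s)
    (hmass : 4 * L ^ s ≤ C.card * δ ^ s)
    (hJ : meetingCost a u s A L ≤ ε * L ^ s) :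
    ∃ c ∈ C, meetingCost a u s c δ ≤ ε * δ ^ s := by
  have hε0 : 0 < ε := by rw [hε]; positivity
  have hLs : 0 < L ^ s := Real.rpow_pos_of_pos hL s
  have hδs : 0 < δ ^ s := Real.rpow_pos_of_pos hδ s
  have hus0 : ∀ n, 0 < u n ^ s := fun n => Real.rpow_pos_of_pos (hu n) s
  -- Average a truncated cost over the children. A child whose truncated cost is at most `ε * δ ^ s`
  -- cannot meet an interval whose cost was truncated, so there the truncation changes nothing.
  set m : ℕ → ℝ := fun n => min (u n ^ s) (2 * ε * δ ^ s) with hm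
  have hm0 : ∀ n, 0 ≤ m n := fun n => le_min (hus0 n).le (by positivity)
  have hms : Summable m := Summable.of_nonneg_of_le hm0 (fun n => min_le_left _ _) hus
  set T : ℝ → ℝ := fun c => ∑' n, if (Icc c (c + δ) ∩ Icc (a n) (a n + u n)).Nonempty
    then m n else 0 with hT
  set G : ℕ → ℝ := fun n => if (Icc A (A + L) ∩ Icc (a n) (a n + u n)).Nonempty
    then u n ^ s else 0 with hG
  have hGs : Summable G := summable_ite_of_nonneg (fun n => (hus0 n).le) hus _
  have hCpos : 0 < (C.card : ℝ) := by
    by_contra h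
    have : (C.card : ℝ) = 0 := le_antisymm (not_lt.mp h) (by positivity)
    rw [this] at hmass; linarith
  have hCne : C.Nonempty := Finset.card_pos.mp (by exact_mod_cast hCpos)
  have hsum : ∑ c ∈ C, T c ≤ ∑ c ∈ C, ε * δ ^ s := by
    rw [hT, ← Summable.tsum_finsetSum (fun c _ => summable_ite_of_nonneg hm0 hms _)]
    have hterm : ∀ n, (∑ c ∈ C, if (Icc c (c + δ) ∩ Icc (a n) (a n + u n)).Nonempty
        then m n else 0) ≤ (1 + 2 * ε * K * C.card * δ ^ s / L ^ s) * G n := by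
      intro n
      rw [← Finset.sum_filter, Finset.sum_const, nsmul_eq_mul]
      by_cases hmeet : (Icc A (A + L) ∩ Icc (a n) (a n + u n)).Nonempty
      · simp only [hG, hmeet, if_true]
        have h1 := hcount (a n) (u n) (hu n)
        rw [Real.div_rpow (hu n).le hL.le] at h1
        calc _ ≤ (1 + K * C.card * (u n ^ s / L ^ s)) * m n :=
              mul_le_mul_of_nonneg_right h1 (hm0 n)
          _ = m n + K * C.card * (u n ^ s / L ^ s) * m n := by ring
          -- The single hit is charged at full cost and the further hits at the truncated cost. With
          -- `ε * K = 1 / 8` and `hmass`, each part contributes at most a quarter of `C.card * (ε *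
          -- δ ^ s)`.
          _ ≤ u n ^ s + K * C.card * (u n ^ s / L ^ s) * (2 * ε * δ ^ s) := by
              have := hus0 n
              gcongr
              · exact min_le_left _ _
              · exact min_le_right _ _
          _ = (1 + 2 * ε * K * C.card * δ ^ s / L ^ s) * u n ^ s := by ring
      · have hemp : C.filter (fun c => (Icc c (c + δ) ∩ Icc (a n) (a n + u n)).Nonempty) = ∅ := by
          refine Finset.filter_eq_empty_iff.mpr fun c hc hx => hmeet ?_
          obtain ⟨x, hx1, hx2⟩ := hx
          exact ⟨x, ⟨(hC c hc).1.trans hx1.1, hx1.2.trans (hC c hc).2⟩, hx2⟩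
        rw [hemp]; simp [hG, hmeet]
    have hs1 : Summable fun n => ∑ c ∈ C, if (Icc c (c + δ) ∩ Icc (a n) (a n + u n)).Nonempty
        then m n else 0 := summable_sum fun c _ => summable_ite_of_nonneg hm0 hms _
    refine (hs1.tsum_le_tsum hterm (hGs.mul_left _)).trans ?_
    rw [tsum_mul_left, Finset.sum_const, nsmul_eq_mul]
    have hJ' : ∑' n, G n ≤ ε * L ^ s := hJ
    have hfac : 0 ≤ 1 + 2 * ε * K * C.card * δ ^ s / L ^ s := by positivity
    calc _ ≤ (1 + 2 * ε * K * C.card * δ ^ s / L ^ s) * (ε * L ^ s) :=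
          mul_le_mul_of_nonneg_left hJ' hfac
      _ = ε * L ^ s + 2 * (ε * K) * ε * C.card * δ ^ s := by field_simp
      _ = ε * L ^ s + ε * (C.card * δ ^ s) / 4 := by
          rw [show ε * K = 1 / 8 by rw [hε]; field_simp]; ring
      _ ≤ C.card * (ε * δ ^ s) := by nlinarith [mul_le_mul_of_nonneg_left hmass hε0.le]
  obtain ⟨c, hc, hTc⟩ := Finset.exists_le_of_sum_le hCne hsum
  refine ⟨c, hc, ?_⟩
  refine le_trans (le_of_eq ?_) hTc
  unfold meetingCost
  simp only [hT]
  refine tsum_congr fun n => ?_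
  split_ifs with hmeet
  · have h1 : m n ≤ ε * δ ^ s := by
      refine le_trans ?_ hTc
      have := (summable_ite_of_nonneg hm0 hms fun n =>
        (Icc c (c + δ) ∩ Icc (a n) (a n + u n)).Nonempty).le_tsum n
        (fun j _ => by split_ifs <;> simp [hm0])
      simpa only [hmeet, if_true] using this
    have h2 : 0 < ε * δ ^ s := by positivity
    rcases min_choice (u n ^ s) (2 * ε * δ ^ s) with h | h
    · exact h.symm
    · simp only [hm] at h1
      rw [h] at h1; linarith
  · rfl

/-- A lower bound for the Hausdorff measure of a limsup set: it suffices that every interval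
`[A, A + L]` contains a well-spread finite family of short intervals `[c, c + δ]` on which
`P N` holds for some large `N`. -/
theorem hausdorffMeasure_ne_zero_of_spread {E : Set ℝ} {s K : ℝ} (hs : 0 < s) (hK : 0 < K)
    (P : ℕ → ℝ → Prop) (hE : ∀ x ∈ Ico (0 : ℝ) 1, (∀ k, ∃ N ≥ k, P N x) → x ∈ E)
    (H : ∀ A L : ℝ, 0 < L → 0 ≤ A → A + L ≤ 1 → ∀ k : ℕ, ∃ (C : Finset ℝ) (δ : ℝ),
      0 < δ ∧ δ ≤ L / 2 ∧ (∀ c ∈ C, A ≤ c ∧ c + δ ≤ A + L) ∧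
      (∀ c ∈ C, ∀ x ∈ Icc c (c + δ), ∃ N ≥ k, P N x) ∧
      (∀ (q : ℝ → Prop) [DecidablePred q] (t v : ℝ), 0 < v →
        (∀ c ∈ C, q c → t - δ ≤ c ∧ c ≤ t + v) →
        ((C.filter q).card : ℝ) ≤ 1 + K * C.card * (v / L) ^ s) ∧
      4 * L ^ s ≤ C.card * δ ^ s) :
    MeasureTheory.Measure.hausdorffMeasure s E ≠ 0 := by
  classical
  intro h0
  set ε : ℝ := 1 / (8 * K) with hε
  have hε0 : 0 < ε := by positivity
  obtain ⟨a, u, hcov, hu, hus, htot⟩ := exists_interval_cover_of_hausdorffMeasure_eq_zero hs h0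
    (η := ε * (1 / 2) ^ s) (by positivity)
  have hus0 : ∀ n, 0 ≤ u n ^ s := fun n => (Real.rpow_pos_of_pos (hu n) s).le
  let S := {p : ℝ × ℝ // 0 < p.2 ∧ 0 ≤ p.1 ∧ p.1 + p.2 ≤ 1 / 2 ∧
    meetingCost a u s p.1 p.2 ≤ ε * p.2 ^ s}
  have step : ∀ (k : ℕ) (J : S), ∃ J' : S, J'.1.2 ≤ J.1.2 / 2 ∧ J.1.1 ≤ J'.1.1 ∧
      J'.1.1 + J'.1.2 ≤ J.1.1 + J.1.2 ∧
      ∀ x ∈ Icc J'.1.1 (J'.1.1 + J'.1.2), ∃ N ≥ k, P N x := by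
    rintro k ⟨⟨A, L⟩, hL, hA, hAL, hJ⟩
    obtain ⟨C, δ, hδ, hδL, hC, hP, hcount, hmass⟩ := H A L hL hA (by dsimp at hAL; linarith) k
    obtain ⟨c, hc, hcost⟩ := exists_child_meetingCost_le hu hus hK hε hL hδ C hC
      (fun t v hv => hcount _ t v hv fun c _ hx => by
        obtain ⟨x, hx1, hx2⟩ := hx
        exact ⟨by linarith [hx1.2, hx2.1], hx1.1.trans hx2.2⟩) hmass hJ
    exact ⟨⟨(c, δ), hδ, hA.trans (hC c hc).1, (hC c hc).2.trans hAL, hcost⟩, hδL,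
      (hC c hc).1, (hC c hc).2, hP c hc⟩
  choose next hnext using step
  have hinit : meetingCost a u s 0 (1 / 2) ≤ ε * (1 / 2) ^ s := by
    refine le_trans ?_ htot
    exact (summable_ite_of_nonneg hus0 hus _).tsum_le_tsum
      (fun n => by split_ifs <;> simp [hus0]) hus
  -- Starting from `[0, 1 / 2]` keeps the limit point strictly below `1`.
  let J : ℕ → S := fun k => Nat.rec ⟨(0, 1 / 2), by norm_num, le_rfl, by norm_num, hinit⟩
    (fun k J => next k J) k
  have hJs : ∀ k, J (k + 1) = next k (J k) := fun k => rfl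
  let I : ℕ → Set ℝ := fun k => Icc (J k).1.1 ((J k).1.1 + (J k).1.2)
  have hIsub : ∀ k, I (k + 1) ⊆ I k := fun k => by
    obtain ⟨-, h1, h2, -⟩ := hnext k (J k)
    rw [← hJs] at h1 h2
    exact Icc_subset_Icc h1 h2
  obtain ⟨x, hx⟩ := IsCompact.nonempty_iInter_of_sequence_nonempty_isCompact_isClosed I hIsub
    (fun k => ⟨(J k).1.1, le_rfl, by linarith [(J k).2.1]⟩) isCompact_Icc (fun k => isClosed_Icc)
  have hx' : ∀ k, x ∈ I k := mem_iInter.mp hx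
  have hxE : x ∈ E := by
    refine hE x ⟨?_, ?_⟩ fun k => ?_
    · exact (J 0).2.2.1.trans (hx' 0).1
    · linarith [(hx' 0).2, (J 0).2.2.2.1]
    · obtain ⟨-, -, -, h⟩ := hnext k (J k)
      rw [← hJs] at h
      exact h x (hx' (k + 1))
  -- This one interval meets every `J k`, so its cost is at most `ε` times the `s`-th power of a
  -- length tending to `0`.
  obtain ⟨n, hn⟩ := mem_iUnion.mp (hcov hxE)
  have hlen : ∀ k, (J k).1.2 ≤ (1 / 2) ^ k := by
    intro k
    induction k with
    | zero => show (1 / 2 : ℝ) ≤ _; norm_num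
    | succ k ih =>
      obtain ⟨h, -⟩ := hnext k (J k)
      rw [← hJs] at h
      rw [pow_succ]; linarith
  have hle : ∀ k, u n ^ s ≤ ε * ((1 / 2 : ℝ) ^ k) ^ s := by
    intro k
    have h1 : u n ^ s ≤ meetingCost a u s (J k).1.1 (J k).1.2 := by
      have := (summable_ite_of_nonneg hus0 hus fun n =>
        (Icc (J k).1.1 ((J k).1.1 + (J k).1.2) ∩ Icc (a n) (a n + u n)).Nonempty).le_tsum n
        (fun j _ => by split_ifs <;> simp [hus0])
      rwa [if_pos ⟨x, hx' k, hn⟩] at this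
    refine h1.trans ((J k).2.2.2.2.trans ?_)
    exact mul_le_mul_of_nonneg_left
      (Real.rpow_le_rpow (J k).2.1.le (hlen k) hs.le) hε0.le
  have hlim : Filter.Tendsto (fun k : ℕ => ε * ((1 / 2 : ℝ) ^ k) ^ s) Filter.atTop (nhds 0) := by
    have h1 := (tendsto_pow_atTop_nhds_zero_of_lt_one (r := (1 / 2 : ℝ)) (by norm_num)
      (by norm_num)).rpow_const (p := s) (Or.inr hs.le)
    rw [Real.zero_rpow hs.ne'] at h1
    simpa using h1.const_mul ε
  have := ge_of_tendsto' hlim hle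
  exact absurd this (not_le.mpr (Real.rpow_pos_of_pos (hu n) s))

/-! ### Part: a Chebyshev lower bound for primes in `(P, 4 P]`. -/

/-- The primes `p` with `P < p ≤ 4 P`. -/
def primesBlock (P : ℕ) : Finset ℕ := (Finset.Ioc P (4 * P)).filter Nat.Prime

theorem mem_primesBlock {P p : ℕ} : p ∈ primesBlock P ↔ (P < p ∧ p ≤ 4 * P) ∧ p.Prime := by
  simp [primesBlock]

theorem theta_sub_theta_le (P : ℕ) :
    Chebyshev.theta ((4 * P : ℕ) : ℝ) - Chebyshev.theta (P : ℝ) ≤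
      (primesBlock P).card * Real.log ((4 * P : ℕ) : ℝ) := by
  have h : Chebyshev.theta ((4 * P : ℕ) : ℝ) = Chebyshev.theta (P : ℝ) +
      ∑ p ∈ primesBlock P, Real.log p := by
    simp only [Chebyshev.theta, Nat.floor_natCast, primesBlock]
    rw [← Finset.sum_union]
    · congr 1
      ext p
      simp only [Finset.mem_filter, Finset.mem_Ioc, Finset.mem_union]
      constructor
      · rintro ⟨⟨h1, h2⟩, h3⟩
        by_cases h4 : p ≤ P
        · exact Or.inl ⟨⟨h1, h4⟩, h3⟩
        · exact Or.inr ⟨⟨by omega, h2⟩, h3⟩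
      · rintro (⟨⟨h1, h2⟩, h3⟩ | ⟨⟨h1, h2⟩, h3⟩)
        · exact ⟨⟨h1, by omega⟩, h3⟩
        · exact ⟨⟨by omega, h2⟩, h3⟩
    · rw [Finset.disjoint_left]
      intro p hp hp'
      simp only [Finset.mem_filter, Finset.mem_Ioc] at hp hp'
      omega
  rw [h, add_sub_cancel_left, ← nsmul_eq_mul]
  refine Finset.sum_le_card_nsmul _ _ _ fun p hp => ?_
  obtain ⟨⟨h1, h2⟩, h3⟩ := mem_primesBlock.mp hp
  exact Real.log_le_log (by exact_mod_cast h3.pos) (by exact_mod_cast h2)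

/-- Chebyshev's bounds have main terms `4 * P * log 2` for `θ(4P)` from below and `P * log 4` for
`θ(P)` from above, leaving `2 * P * log 2`. On `(P, 2 P]` the same main terms would cancel, hence
the factor `4`. -/
theorem eventually_rpow_le_card_primesBlock {ε : ℝ} (hε : 0 < ε) :
    ∀ᶠ P : ℕ in Filter.atTop, (P : ℝ) ^ (1 - ε) ≤ (primesBlock P).card := by
  have htend : Filter.Tendsto (fun P : ℕ => ((4 * P : ℕ) : ℝ)) Filter.atTop Filter.atTop :=
    tendsto_natCast_atTop_atTop.comp (Filter.tendsto_id.const_mul_atTop' (by norm_num))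
  have h1 := htend.eventually ((isLittleO_log_rpow_atTop hε).bound (c := 1 / 100) (by norm_num))
  have h2 := htend.eventually
    ((isLittleO_log_rpow_atTop (r := 1 / 2) (by norm_num)).bound (c := 1 / 100) (by norm_num))
  filter_upwards [h1, h2, Filter.eventually_ge_atTop 1] with P hP1 hP2 hP
  have hth := theta_sub_theta_le P
  have hge := Chebyshev.theta_ge (4 * P)
  have hle := Chebyshev.theta_le_log4_mul_x (x := (P : ℝ)) (by positivity)
  have hP' : (1 : ℝ) ≤ P := by exact_mod_cast hP
  have hxP : ((4 * P : ℕ) : ℝ) = 4 * P := by push_cast; ring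
  rw [hxP] at hth hge hP1 hP2
  set x : ℝ := 4 * P with hx
  have hx4 : 4 ≤ x := by linarith
  have hx0 : 0 < x := by linarith
  have hlog0 : 0 < Real.log x := Real.log_pos (by linarith)
  rw [Real.norm_of_nonneg hlog0.le, Real.norm_of_nonneg (by positivity)] at hP1 hP2
  rw [← Real.sqrt_eq_rpow] at hP2
  have hsq : √x * √x = x := Real.mul_self_sqrt hx0.le
  have hsq1 : 1 ≤ √x := Real.one_le_sqrt.mpr (by linarith)
  have hlog4 : Real.log 4 = 2 * Real.log 2 := by
    rw [show (4 : ℝ) = 2 ^ 2 by norm_num, Real.log_pow]; norm_num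
  have hlog2 := Real.log_two_gt_d9
  have hlogx1 : Real.log (x + 1) ≤ 2 * Real.log x := by
    rw [show 2 * Real.log x = Real.log (x ^ 2) by rw [Real.log_pow]; norm_num]
    exact Real.log_le_log (by linarith) (by nlinarith)
  have hpow : (P : ℝ) ^ (1 - ε) * Real.log x ≤ 1 / 100 * x := by
    have e1 : (P : ℝ) ^ (1 - ε) * x ^ ε = x * (1 / 4) ^ (1 - ε) := by
      rw [show (P : ℝ) = x * (1 / 4) by rw [hx]; ring, Real.mul_rpow hx0.le (by norm_num),
        mul_right_comm, ← Real.rpow_add hx0]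
      simp
    rcases le_total ε 1 with hε1 | hε1
    · have e3 : (1 / 4 : ℝ) ^ (1 - ε) ≤ 1 :=
        Real.rpow_le_one (by norm_num) (by norm_num) (by linarith)
      calc (P : ℝ) ^ (1 - ε) * Real.log x ≤ (P : ℝ) ^ (1 - ε) * (1 / 100 * x ^ ε) := by gcongr
        _ = 1 / 100 * (x * (1 / 4) ^ (1 - ε)) := by rw [← e1]; ring
        _ ≤ 1 / 100 * (x * 1) := by gcongr
        _ = _ := by ring
    · have e3 : (P : ℝ) ^ (1 - ε) ≤ 1 := Real.rpow_le_one_of_one_le_of_nonpos hP' (by linarith)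
      calc (P : ℝ) ^ (1 - ε) * Real.log x ≤ 1 * Real.log x := by gcongr
        _ ≤ 1 / 100 * √x := by linarith
        _ ≤ 1 / 100 * x := by nlinarith
  have hkey : (P : ℝ) ^ (1 - ε) * Real.log x ≤ (primesBlock P).card * Real.log x := by
    refine le_trans ?_ hth
    have hp4 : (P : ℝ) = x / 4 := by rw [hx]; ring
    have hA : √x * Real.log x ≤ 1 / 100 * x := by nlinarith
    have hB : Real.log x ≤ 1 / 100 * x := by nlinarith
    have hC : Real.log 4 * (P : ℝ) = x * Real.log 2 / 2 := by rw [hlog4, hp4]; ring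
    have hD : 0.69 * x ≤ x * Real.log 2 := by nlinarith
    rw [hC] at hle
    have hE : 2 * √x * Real.log x ≤ 1 / 50 * x := by linarith
    linarith
  exact le_of_mul_le_mul_right hkey hlog0

/-! ### Part: counting and spacing of the fractions `a / p ^ e`. -/

/-- A `ρ`-separated finite set of reals in an interval of length `v` has at most `1 + v / ρ`
elements. -/
theorem card_le_of_separated {S : Finset ℝ} {ρ t v : ℝ} (hρ : 0 < ρ) (hv : 0 ≤ v)
    (hS : ∀ c ∈ S, t ≤ c ∧ c ≤ t + v) (hsep : ∀ c ∈ S, ∀ c' ∈ S, c ≠ c' → ρ ≤ |c - c'|) :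
    (S.card : ℝ) ≤ 1 + v / ρ := by
  have hcard : S.card ≤ (Finset.range (⌊v / ρ⌋₊ + 1)).card := by
    refine Finset.card_le_card_of_injOn (fun c => ⌊(c - t) / ρ⌋₊) ?_ ?_
    · intro c hc
      obtain ⟨h1, h2⟩ := hS c hc
      simp only [Finset.coe_range, mem_Iio, Nat.lt_add_one_iff]
      exact Nat.floor_le_floor (by gcongr; linarith)
    · intro c hc c' hc' h
      by_contra hne
      have h1 := hsep c hc c' hc' hne
      have ha : 0 ≤ (c - t) / ρ := div_nonneg (by linarith [(hS c hc).1]) hρ.le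
      have hb : 0 ≤ (c' - t) / ρ := div_nonneg (by linarith [(hS c' hc').1]) hρ.le
      have h2 := Nat.floor_le ha
      have h3 := Nat.lt_floor_add_one ((c - t) / ρ)
      have h4 := Nat.floor_le hb
      have h5 := Nat.lt_floor_add_one ((c' - t) / ρ)
      simp only at h
      rw [h] at h2 h3
      have h6 : |(c - c') / ρ| < 1 := by
        rw [abs_lt]
        have : (c - c') / ρ = (c - t) / ρ - (c' - t) / ρ := by ring
        constructor <;> linarith
      rw [abs_div, abs_of_pos hρ, div_lt_one hρ] at h6
      linarith
  rw [Finset.card_range] at hcard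
  calc (S.card : ℝ) ≤ ((⌊v / ρ⌋₊ + 1 : ℕ) : ℝ) := by exact_mod_cast hcard
    _ ≤ 1 + v / ρ := by push_cast; linarith [Nat.floor_le (div_nonneg hv hρ.le)]

theorem card_nat_le_of_mem_Icc {S : Finset ℕ} {t v : ℝ} (hv : 0 ≤ v)
    (hS : ∀ a ∈ S, t ≤ (a : ℝ) ∧ (a : ℝ) ≤ t + v) : (S.card : ℝ) ≤ 1 + v := by
  have h := card_le_of_separated (S := S.map Nat.castEmbedding) (ρ := 1) (t := t) one_pos hv
    (by simpa using hS) (by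
      simp only [Finset.mem_map, Nat.castEmbedding_apply]
      rintro _ ⟨a, -, rfl⟩ _ ⟨b, -, rfl⟩ hne
      have hab : (a : ℤ) - b ≠ 0 := by
        intro h; apply hne; congr 1; omega
      exact_mod_cast Int.one_le_abs hab)
  simpa using h

/-- Among the integers in `[x, y]` at least a quarter of the expected number are coprime to `p`. -/
theorem le_card_filter_not_dvd {x y : ℝ} {p : ℕ} (hx : 0 ≤ x) (hxy : x + 8 ≤ y) (hp : 2 ≤ p) :
    (y - x) / 4 ≤ ((Finset.Icc ⌈x⌉₊ ⌊y⌋₊).filter fun a => ¬ p ∣ a).card := by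
  have hy : 0 ≤ y := by linarith
  have hp' : (2 : ℝ) ≤ p := by exact_mod_cast hp
  have hp0 : (0 : ℝ) < p := by linarith
  have htot : y - x - 1 ≤ ((Finset.Icc ⌈x⌉₊ ⌊y⌋₊).card : ℝ) := by
    have h1 := Nat.ceil_lt_add_one hx
    have h2 := Nat.lt_floor_add_one y
    have h3 : ((⌊y⌋₊ + 1 : ℕ) : ℝ) ≤ ((⌊y⌋₊ + 1 - ⌈x⌉₊ : ℕ) : ℝ) + (⌈x⌉₊ : ℝ) := by
      exact_mod_cast (by omega : ⌊y⌋₊ + 1 ≤ ⌊y⌋₊ + 1 - ⌈x⌉₊ + ⌈x⌉₊)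
    rw [Nat.card_Icc]
    push_cast at h3 ⊢
    linarith
  have hmul : (((Finset.Icc ⌈x⌉₊ ⌊y⌋₊).filter fun a => p ∣ a).card : ℝ) ≤ 1 + (y - x) / p := by
    have hinj : Set.InjOn (fun a => a / p)
        ((Finset.Icc ⌈x⌉₊ ⌊y⌋₊).filter fun a => p ∣ a : Finset ℕ) := by
      intro a ha b hb h
      simp only [Finset.coe_filter, mem_ofPred_eq] at ha hb
      rw [← Nat.div_mul_cancel ha.2, ← Nat.div_mul_cancel hb.2]
      simp only at h
      rw [h]
    rw [← Finset.card_image_of_injOn hinj]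
    refine card_nat_le_of_mem_Icc (t := x / p) (div_nonneg (by linarith) hp0.le) ?_
    intro b hb
    obtain ⟨a, ha, rfl⟩ := Finset.mem_image.mp hb
    obtain ⟨ha1, ha2⟩ := Finset.mem_filter.mp ha
    obtain ⟨h1, h2⟩ := Finset.mem_Icc.mp ha1
    have h1' : x ≤ a := Nat.ceil_le.mp h1
    have h2' : (a : ℝ) ≤ y := (Nat.le_floor_iff hy).mp h2
    rw [Nat.cast_div ha2 hp0.ne', ← add_div]
    constructor
    · gcongr
    · gcongr; linarith
  have hsplit := Finset.card_filter_add_card_filter_not (s := Finset.Icc ⌈x⌉₊ ⌊y⌋₊) (fun a => p ∣ a)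
  have hsplit' : (((Finset.Icc ⌈x⌉₊ ⌊y⌋₊).filter fun a => p ∣ a).card : ℝ) +
    (((Finset.Icc ⌈x⌉₊ ⌊y⌋₊).filter fun a => ¬ p ∣ a).card : ℝ) =
      ((Finset.Icc ⌈x⌉₊ ⌊y⌋₊).card : ℝ) := by exact_mod_cast hsplit
  have hdiv : (y - x) / p ≤ (y - x) / 2 := by gcongr; linarith
  linarith

/-- The fractions `a / p ^ e` in `[A, B]` with `p ∤ a` and `p` a prime in `(P, 4 P]`. -/
noncomputable def primePowFractions (e P : ℕ) (A B : ℝ) : Finset ℝ :=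
  (primesBlock P).biUnion fun p =>
    ((Finset.Icc ⌈A * p ^ e⌉₊ ⌊B * p ^ e⌋₊).filter fun a => ¬ p ∣ a).image
      fun a : ℕ => (a : ℝ) / (p : ℝ) ^ e

theorem mem_primePowFractions {e P : ℕ} {A B : ℝ} (hB : 0 ≤ B) {c : ℝ}
    (hc : c ∈ primePowFractions e P A B) : ∃ p a : ℕ, p ∈ primesBlock P ∧ ¬ p ∣ a ∧
      c = (a : ℝ) / (p : ℝ) ^ e ∧ A ≤ c ∧ c ≤ B := by
  simp only [primePowFractions, Finset.mem_biUnion, Finset.mem_image, Finset.mem_filter,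
    Finset.mem_Icc] at hc
  obtain ⟨p, hp, a, ⟨⟨h1, h2⟩, h3⟩, rfl⟩ := hc
  have hp0 : (0 : ℝ) < (p : ℝ) ^ e := by
    have := (mem_primesBlock.mp hp).2.pos
    positivity
  refine ⟨p, a, hp, h3, rfl, ?_, ?_⟩
  · rw [le_div_iff₀ hp0]; exact Nat.ceil_le.mp h1
  · rw [div_le_iff₀ hp0]; exact (Nat.le_floor_iff (by positivity)).mp h2

theorem pow_primesBlock_le {P p : ℕ} (hp : p ∈ primesBlock P) (e : ℕ) :
    (p : ℝ) ^ e ≤ (4 * (P : ℝ)) ^ e := by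
  have : (p : ℝ) ≤ 4 * P := by exact_mod_cast (mem_primesBlock.mp hp).1.2
  gcongr

theorem div_prime_pow_eq_iff {p r a b e : ℕ} (he : 1 ≤ e) (hp : p.Prime) (hr : r.Prime)
    (ha : ¬ p ∣ a) (hb : ¬ r ∣ b) (h : a * r ^ e = b * p ^ e) : p = r ∧ a = b := by
  have h1 : p ∣ a * r ^ e := h ▸ Dvd.dvd.mul_left (dvd_pow_self p (by omega)) b
  have h2 : p = r := (Nat.prime_dvd_prime_iff_eq hp hr).mp
    (hp.dvd_of_dvd_pow ((hp.dvd_mul.mp h1).resolve_left ha))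
  subst h2
  exact ⟨rfl, Nat.eq_of_mul_eq_mul_right (pow_pos hp.pos e) h⟩

/-- The difference of two distinct fractions has a nonzero integer numerator over the product of the
denominators. -/
theorem primePowFractions_separated {e P : ℕ} {A B : ℝ} (hB : 0 ≤ B) {c c' : ℝ}
    (hc : c ∈ primePowFractions e P A B) (hc' : c' ∈ primePowFractions e P A B) (hne : c ≠ c') :
    1 / (4 * (P : ℝ)) ^ (2 * e) ≤ |c - c'| := by
  obtain ⟨p, a, hp, ha, rfl, -, -⟩ := mem_primePowFractions hB hc
  obtain ⟨r, b, hr, hb, rfl, -, -⟩ := mem_primePowFractions hB hc'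
  have hp0 : (0 : ℝ) < (p : ℝ) ^ e := by
    have := (mem_primesBlock.mp hp).2.pos
    positivity
  have hr0 : (0 : ℝ) < (r : ℝ) ^ e := by
    have := (mem_primesBlock.mp hr).2.pos
    positivity
  have hint : (1 : ℝ) ≤ |(a : ℝ) * r ^ e - p ^ e * b| := by
    have hz : (a : ℤ) * r ^ e - p ^ e * b ≠ 0 := by
      intro h0
      apply hne
      rw [div_eq_div_iff hp0.ne' hr0.ne']
      have : (a : ℤ) * r ^ e = b * p ^ e := by linarith
      exact_mod_cast this
    exact_mod_cast Int.one_le_abs hz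
  rw [div_sub_div _ _ hp0.ne' hr0.ne', abs_div, abs_of_pos (mul_pos hp0 hr0)]
  refine div_le_div₀ (abs_nonneg _) hint (mul_pos hp0 hr0) ?_
  rw [two_mul, pow_add]
  have := pow_primesBlock_le hp e
  have := pow_primesBlock_le hr e
  gcongr

/-- Reduced fractions with different prime bases are distinct, so the counts for the primes add up.
The hypothesis `hP` makes the range of numerators long enough, at least `8`, for the quarter bound.
-/
theorem le_card_primePowFractions {e P : ℕ} (he : 1 ≤ e) {A L : ℝ} (hA : 0 ≤ A) (hL : 0 < L)
    (hP : 16 ≤ L * (P : ℝ) ^ e) :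
    (primesBlock P).card * (L * (P : ℝ) ^ e / 8) ≤
      (primePowFractions e P A (A + L / 2)).card := by
  have hdisj : Set.PairwiseDisjoint (primesBlock P : Set ℕ) fun p =>
      ((Finset.Icc ⌈A * p ^ e⌉₊ ⌊(A + L / 2) * p ^ e⌋₊).filter fun a => ¬ p ∣ a).image
      fun a : ℕ => (a : ℝ) / (p : ℝ) ^ e := by
    intro p hp r hr hpr
    refine Finset.disjoint_left.mpr fun c hc hc' => hpr ?_
    simp only [Finset.mem_image, Finset.mem_filter] at hc hc'
    obtain ⟨a, ⟨-, ha⟩, rfl⟩ := hc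
    obtain ⟨b, ⟨-, hb⟩, h⟩ := hc'
    have hp1 := (mem_primesBlock.mp hp).2
    have hr1 := (mem_primesBlock.mp hr).2
    have hp0 : (p : ℝ) ^ e ≠ 0 := by exact_mod_cast (pow_pos hp1.pos e).ne'
    have hr0 : (r : ℝ) ^ e ≠ 0 := by exact_mod_cast (pow_pos hr1.pos e).ne'
    rw [div_eq_div_iff hr0 hp0] at h
    exact (div_prime_pow_eq_iff he hp1 hr1 ha hb (by exact_mod_cast h.symm)).1
  rw [primePowFractions, Finset.card_biUnion hdisj]
  push_cast
  rw [← nsmul_eq_mul]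
  refine Finset.card_nsmul_le_sum _ _ _ fun p hp => ?_
  have hpp := (mem_primesBlock.mp hp).2
  have hp0 : (0 : ℝ) < (p : ℝ) ^ e := by
    have := hpp.pos
    positivity
  have hPp : (P : ℝ) ^ e ≤ (p : ℝ) ^ e := by
    have : (P : ℝ) ≤ p := by exact_mod_cast (mem_primesBlock.mp hp).1.1.le
    gcongr
  rw [Finset.card_image_of_injective _ fun a b h => by
    simpa [div_left_inj' hp0.ne'] using h]
  have hLP : L * (P : ℝ) ^ e ≤ L * (p : ℝ) ^ e := by gcongr
  refine le_trans ?_ (le_card_filter_not_dvd (by positivity) ?_ hpp.two_le)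
  · linarith
  · linarith

/-- Counting prime by prime is efficient for long intervals; the separation bound takes over for
short ones. -/
theorem card_filter_primePowFractions_le {e P : ℕ} {A B : ℝ} (q : ℝ → Prop) [DecidablePred q]
    {t v : ℝ} (hv : 0 ≤ v)
    (hq : ∀ c ∈ primePowFractions e P A B, q c → t ≤ c ∧ c ≤ t + v) :
    (((primePowFractions e P A B).filter q).card : ℝ) ≤
      (primesBlock P).card * (1 + v * (4 * (P : ℝ)) ^ e) := by
  have h1 : ((primePowFractions e P A B).filter q).card ≤ ∑ p ∈ primesBlock P,
      (((Finset.Icc ⌈A * p ^ e⌉₊ ⌊B * p ^ e⌋₊).filter fun a => ¬ p ∣ a).filter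
        fun a : ℕ => q ((a : ℝ) / (p : ℝ) ^ e)).card := by
    rw [primePowFractions, Finset.filter_biUnion]
    refine Finset.card_biUnion_le.trans (Finset.sum_le_sum fun p _ => ?_)
    rw [Finset.filter_image]
    exact Finset.card_image_le
  calc (((primePowFractions e P A B).filter q).card : ℝ) ≤ ((∑ p ∈ primesBlock P,
      (((Finset.Icc ⌈A * p ^ e⌉₊ ⌊B * p ^ e⌋₊).filter fun a => ¬ p ∣ a).filter
        fun a : ℕ => q ((a : ℝ) / (p : ℝ) ^ e)).card : ℕ) : ℝ) := Nat.cast_le.mpr h1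
    _ ≤ (primesBlock P).card • (1 + v * (4 * (P : ℝ)) ^ e) := by
      push_cast
      refine Finset.sum_le_card_nsmul _ _ _ fun p hp => ?_
      have hp0 : (0 : ℝ) < (p : ℝ) ^ e := by
        have := (mem_primesBlock.mp hp).2.pos
        positivity
      refine (card_nat_le_of_mem_Icc (t := t * (p : ℝ) ^ e) (v := v * (p : ℝ) ^ e)
        (by positivity) fun a ha => ?_).trans ?_
      · obtain ⟨ha1, ha2⟩ := Finset.mem_filter.mp ha
        have hmem : (a : ℝ) / (p : ℝ) ^ e ∈ primePowFractions e P A B :=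
          Finset.mem_biUnion.mpr ⟨p, hp, Finset.mem_image_of_mem _ ha1⟩
        obtain ⟨h2, h3⟩ := hq _ hmem ha2
        rw [le_div_iff₀ hp0] at h2
        rw [div_le_iff₀ hp0] at h3
        exact ⟨h2, by linarith⟩
      · have := pow_primesBlock_le hp e
        gcongr
    _ = _ := nsmul_eq_mul _ _

/-! ### Part: the Jarník-type dimension bound. -/

/-- Here `W` counts primes, `M` all fractions, and `X` those near an interval of length `u`. Four
ranges of `u` are cut at `L`, `x ^ (-e)` and `x ^ (-β)`. Above `L` the trivial bound suffices; in
the two middle ranges the prime-by-prime count is used, with `h1` when its constant term dominates;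
below `x ^ (-β)` separation and `h2` suffice. -/
theorem spread_count_bound {x L s β ε W M u X : ℝ} {e : ℕ} (hx : 1 ≤ x) (hL : 0 < L)
    (hs0 : 0 < s) (hs1 : s < 1) (hW : x ^ (1 - ε) ≤ W)
    (hM : W * (L * x ^ e / 8) ≤ M) (hu : 0 < u)
    (h1 : 1 ≤ x ^ (e - β * s) * L ^ (1 - s))
    (h2 : 2 * 16 ^ e * x ^ (e - 1 + ε - β * (1 - s)) ≤ L ^ (1 - s))
    (hX1 : X ≤ M) (hX2 : X ≤ 1 + 2 * u * (4 * x) ^ (2 * e))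
    (hX3 : X ≤ W * (1 + 2 * u * (4 * x) ^ e)) :
    X ≤ 1 + 8 * (1 + 2 * 4 ^ e) * M * (u / L) ^ s := by
  have hx0 : 0 < x := by linarith
  have hW0 : 0 < W := (Real.rpow_pos_of_pos hx0 _).trans_le hW
  have hM0 : 0 < M := lt_of_lt_of_le (by positivity) hM
  have h4e : (1 : ℝ) ≤ 8 * (1 + 2 * 4 ^ e) := by
    have : (0 : ℝ) < 4 ^ e := by positivity
    linarith
  have hLs : L = L ^ (1 - s) * L ^ s := by rw [← Real.rpow_add hL]; simp
  have hus : u = u ^ (1 - s) * u ^ s := by rw [← Real.rpow_add hu]; simp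
  have hLs0 : 0 < L ^ s := Real.rpow_pos_of_pos hL s
  have hus0 : 0 < u ^ s := Real.rpow_pos_of_pos hu s
  have hdiv : (u / L) ^ s = u ^ s / L ^ s := Real.div_rpow hu.le hL.le s
  rcases le_or_gt L u with hLu | hLu
  · have h3 : 1 ≤ (u / L) ^ s := Real.one_le_rpow ((one_le_div hL).mpr hLu) hs0.le
    have h4 : M * 1 ≤ M * (u / L) ^ s := by gcongr
    have h5 : 1 * (M * (u / L) ^ s) ≤ 8 * (1 + 2 * 4 ^ e) * (M * (u / L) ^ s) := by gcongr
    linarith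
  have hKM : ∀ r, 0 ≤ r → (1 + 2 * 4 ^ e) * W * (L * x ^ e) * r ≤ 8 * (1 + 2 * 4 ^ e) * M * r := by
    intro r hr
    refine mul_le_mul_of_nonneg_right ?_ hr
    calc (1 + 2 * 4 ^ e) * W * (L * x ^ e) = 8 * (1 + 2 * 4 ^ e) * (W * (L * x ^ e / 8)) := by ring
      _ ≤ _ := by gcongr
  have hfin := hKM ((u / L) ^ s) (by positivity)
  rw [mul_pow] at hX3
  rcases le_or_gt 1 (u * x ^ e) with hux | hux
  · have h3 : u / L ≤ (u / L) ^ s := by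
      conv_lhs => rw [← Real.rpow_one (u / L)]
      exact Real.rpow_le_rpow_of_exponent_ge (by positivity) ((div_le_one hL).mpr hLu.le) hs1.le
    have h4 : X ≤ (1 + 2 * 4 ^ e) * W * (L * x ^ e) * (u / L) ^ s := calc
      X ≤ W * (1 + 2 * u * (4 ^ e * x ^ e)) := hX3
      _ ≤ W * (u * x ^ e + 2 * u * (4 ^ e * x ^ e)) := by gcongr
      _ = (1 + 2 * 4 ^ e) * W * (L * x ^ e) * (u / L) := by field_simp
      _ ≤ _ := by gcongr
    linarith
  rcases le_or_gt (x ^ (-β)) u with hβ | hβ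
  · have h3 : x ^ (-(β * s)) ≤ u ^ s := by
      rw [← neg_mul, Real.rpow_mul hx0.le]
      exact Real.rpow_le_rpow (by positivity) hβ hs0.le
    have h4 : x ^ (e - β * s) = x ^ e * x ^ (-(β * s)) := by
      rw [sub_eq_add_neg, Real.rpow_add hx0, Real.rpow_natCast]
    have h5 : X ≤ (1 + 2 * 4 ^ e) * W * (L * x ^ e) * (u / L) ^ s := calc
      X ≤ W * (1 + 2 * u * (4 ^ e * x ^ e)) := hX3
      _ = W * (1 + 2 * 4 ^ e * (u * x ^ e)) := by ring
      _ ≤ W * (1 + 2 * 4 ^ e * 1) := by gcongr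
      _ = (1 + 2 * 4 ^ e) * W * 1 := by ring
      _ ≤ (1 + 2 * 4 ^ e) * W * (x ^ (e - β * s) * L ^ (1 - s)) := by gcongr
      _ ≤ (1 + 2 * 4 ^ e) * W * (x ^ e * u ^ s * L ^ (1 - s)) := by rw [h4]; gcongr
      _ = (1 + 2 * 4 ^ e) * W * (L * x ^ e) * (u / L) ^ s := by
        rw [hdiv]; nth_rewrite 2 [hLs]; field_simp
    linarith
  · have h3 : u ^ (1 - s) ≤ x ^ (-(β * (1 - s))) := by
      rw [← neg_mul, Real.rpow_mul hx0.le]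
      exact Real.rpow_le_rpow hu.le hβ.le (by linarith)
    have h4 : x ^ (2 * e) * x ^ (-(β * (1 - s))) =
        x ^ (1 - ε) * x ^ e * x ^ (e - 1 + ε - β * (1 - s)) := by
      rw [← Real.rpow_natCast, ← Real.rpow_natCast x e, ← Real.rpow_add hx0, ← Real.rpow_add hx0,
        ← Real.rpow_add hx0]
      congr 1; push_cast; ring
    have h16 : (4 * x) ^ (2 * e) = 16 ^ e * x ^ (2 * e) := by
      rw [mul_pow, pow_mul]; norm_num
    have h5 : 2 * u * (4 * x) ^ (2 * e) ≤ 1 * W * (L * x ^ e) * (u / L) ^ s := calc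
      2 * u * (4 * x) ^ (2 * e) = 2 * 16 ^ e * (x ^ (2 * e) * u ^ (1 - s)) * u ^ s := by
        rw [h16]; nth_rewrite 1 [hus]; ring
      _ ≤ 2 * 16 ^ e * (x ^ (2 * e) * x ^ (-(β * (1 - s)))) * u ^ s := by gcongr
      _ = x ^ (1 - ε) * x ^ e * (2 * 16 ^ e * x ^ (e - 1 + ε - β * (1 - s))) * u ^ s := by
        rw [h4]; ring
      _ ≤ W * x ^ e * L ^ (1 - s) * u ^ s := by gcongr
      _ = 1 * W * (L * x ^ e) * (u / L) ^ s := by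
        rw [hdiv]; nth_rewrite 2 [hLs]; field_simp
    have h6 : 1 * W * (L * x ^ e) * (u / L) ^ s ≤
        (1 + 2 * 4 ^ e) * W * (L * x ^ e) * (u / L) ^ s := by
      have : (0 : ℝ) < 4 ^ e := by positivity
      gcongr
      linarith
    linarith

theorem eventually_le_natCast_rpow {γ : ℝ} (hγ : 0 < γ) (C : ℝ) :
    ∀ᶠ P : ℕ in Filter.atTop, C ≤ (P : ℝ) ^ γ :=
  ((tendsto_rpow_atTop hγ).comp tendsto_natCast_atTop_atTop).eventually_ge_atTop C

/-- A Jarník-type lower bound: if `Q N` holds for some large `N` throughout the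
`p ^ (-τ)`-neighbourhood to the right of each reduced fraction `a / p ^ e` with large prime `p`,
then the limsup set of `Q` has dimension at least `s`, for suitable `s < (e + 1) / τ`. -/
theorem le_dimH_of_near_primePow_fractions {E : Set ℝ} {e : ℕ} {s τ : ℝ} (he : 1 ≤ e)
    (hs0 : 0 < s) (hs1 : s < 1) (hse : s * (2 * e - 1) < e) (hsτ : s * τ < e + 1)
    (hτ : 2 * e < τ) (Q : ℕ → ℝ → Prop)
    (hE : ∀ x ∈ Ico (0 : ℝ) 1, (∀ k, ∃ N ≥ k, Q N x) → x ∈ E)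
    (hQ : ∀ k : ℕ, ∃ p₀ : ℕ, ∀ p ≥ p₀, p.Prime → ∀ a : ℕ, ¬ p ∣ a → ∀ x : ℝ,
      (a : ℝ) / (p : ℝ) ^ e ≤ x → x ≤ (a : ℝ) / (p : ℝ) ^ e + (p : ℝ) ^ (-τ) → ∃ N ≥ k, Q N x) :
    ENNReal.ofReal s ≤ dimH E := by
  have he' : (1 : ℝ) ≤ e := by exact_mod_cast he
  have h1s : 0 < 1 - s := by linarith
  -- The two bounds on the cut `β` come from `h2` and `h1` of `spread_count_bound`; they are
  -- compatible exactly when `s * (2 * e - 1) < e`.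
  obtain ⟨β, hβ1, hβ2⟩ : ∃ β : ℝ, (e - 1) / (1 - s) < β ∧ β < e / s :=
    exists_between (by rw [div_lt_div_iff₀ h1s hs0]; linarith)
  rw [div_lt_iff₀ h1s] at hβ1
  rw [lt_div_iff₀ hs0] at hβ2
  obtain ⟨ε, hε0, hε⟩ : ∃ ε : ℝ, 0 < ε ∧ ε < min (β * (1 - s) - (e - 1)) (e + 1 - s * τ) :=
    exists_between (lt_min (by linarith) (by linarith))
  obtain ⟨hε1, hε2⟩ := lt_min_iff.mp hε
  have hτ0 : 0 < τ := by linarith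
  have hne := hausdorffMeasure_ne_zero_of_spread (E := E) hs0
    (K := 8 * (1 + 2 * 4 ^ e)) (by positivity) Q hE ?_
  · have := le_dimH_of_hausdorffMeasure_ne_zero (d := ⟨s, hs0.le⟩) hne
    rwa [ENNReal.ofReal, Real.toNNReal_of_nonneg hs0.le]
  intro A L hL hA _ k
  obtain ⟨p₀, hp₀⟩ := hQ k
  have hL1s : 0 < L ^ (1 - s) := Real.rpow_pos_of_pos hL _
  have ev := (eventually_rpow_le_card_primesBlock hε0).and <|
    (eventually_le_natCast_rpow (γ := e) (by linarith) (16 / L)).and <|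
    (eventually_le_natCast_rpow (γ := e - β * s) (by linarith) (1 / L ^ (1 - s))).and <|
    (eventually_le_natCast_rpow (γ := -(e - 1 + ε - β * (1 - s))) (by linarith)
      (2 * 16 ^ e / L ^ (1 - s))).and <|
    (eventually_le_natCast_rpow (γ := e + 1 - ε - s * τ) (by linarith)
      (32 * 4 ^ (s * τ) / L ^ (1 - s))).and <|
    (eventually_le_natCast_rpow (γ := τ - 2 * e) (by linarith) 2).and <|
    (eventually_le_natCast_rpow (γ := τ) hτ0 (2 / L)).and <|
    Filter.eventually_ge_atTop (max 1 p₀)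
  obtain ⟨P, hP1, hP2, hP3, hP4, hP5, hP6, hP7, hP8⟩ := ev.exists
  have hx : (1 : ℝ) ≤ P := by exact_mod_cast (le_max_left _ _).trans hP8
  have hPp₀ : p₀ ≤ P := (le_max_right _ _).trans hP8
  set x : ℝ := (P : ℝ) with hxdef
  have hx0 : 0 < x := by linarith
  have h4x : (0 : ℝ) < 4 * x := by linarith
  rw [div_le_iff₀ hL, Real.rpow_natCast, mul_comm] at hP2
  rw [div_le_iff₀ hL1s] at hP3
  rw [Real.rpow_neg hx0.le, div_le_iff₀ hL1s, inv_mul_eq_div, le_div_iff₀ (by positivity)] at hP4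
  rw [div_le_iff₀ hL1s] at hP5
  -- Since `p ≤ 4 * P`, this length is admissible for every prime in the block.
  set δ : ℝ := (4 * x) ^ (-τ) with hδ
  have hδ0 : 0 < δ := Real.rpow_pos_of_pos h4x _
  have hδL : δ ≤ L / 2 := by
    rw [hδ, Real.rpow_neg h4x.le, inv_le_comm₀ (by positivity) (by positivity), inv_div]
    exact hP7.trans (Real.rpow_le_rpow hx0.le (by linarith) hτ0.le)
  set ρ : ℝ := 1 / (4 * x) ^ (2 * e) with hρ
  have hρ0 : 0 < ρ := by positivity
  have hδρ : 2 * δ ≤ ρ := by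
    have h1 : (2 : ℝ) ≤ (4 * x) ^ (τ - 2 * e) :=
      hP6.trans (Real.rpow_le_rpow hx0.le (by linarith) (by linarith))
    have h2 : ρ = δ * (4 * x) ^ (τ - 2 * e) := by
      rw [hρ, hδ, ← Real.rpow_add h4x, one_div, ← Real.rpow_natCast, ← Real.rpow_neg h4x.le]
      congr 1; push_cast; ring
    rw [h2]; nlinarith
  have hBnn : 0 ≤ A + L / 2 := by linarith
  -- Left endpoints stay in the left half, leaving room for `δ ≤ L / 2`.
  set C := primePowFractions e P A (A + L / 2) with hC
  have hcard := le_card_primePowFractions he hA hL hP2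
  refine ⟨C, δ, hδ0, hδL, ?_, ?_, ?_, ?_⟩
  · intro c hc
    obtain ⟨-, -, -, -, -, h1, h2⟩ := mem_primePowFractions hBnn hc
    exact ⟨h1, by linarith⟩
  · intro c hc y hy
    obtain ⟨p, a, hp, ha, rfl, -, -⟩ := mem_primePowFractions hBnn hc
    obtain ⟨⟨hPp, hp4⟩, hpp⟩ := mem_primesBlock.mp hp
    refine hp₀ p (hPp₀.trans hPp.le) hpp a ha y hy.1 (hy.2.trans ?_)
    have hp0 : (0 : ℝ) < p := by exact_mod_cast hpp.pos
    have : (p : ℝ) ≤ 4 * x := by rw [hxdef]; exact_mod_cast hp4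
    have : δ ≤ (p : ℝ) ^ (-τ) := Real.rpow_le_rpow_of_nonpos hp0 this (by linarith)
    linarith
  · intro q _ t v hv hq
    have hsepcard : ((C.filter q).card : ℝ) ≤ 1 + (v + δ) / ρ := by
      refine card_le_of_separated hρ0 (t := t - δ) (by linarith) (fun c hc => ?_) ?_
      · obtain ⟨h1, h2⟩ := Finset.mem_filter.mp hc
        obtain ⟨h3, h4⟩ := hq c h1 h2
        exact ⟨h3, by linarith⟩
      · intro c hc c' hc' hcc
        exact primePowFractions_separated hBnn (Finset.mem_filter.mp hc).1
          (Finset.mem_filter.mp hc').1 hcc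
    -- Below half the spacing at most one fraction is hit, because `2 * δ ≤ ρ`; otherwise enlarging
    -- `v` by `δ` costs at most a factor `2`.
    rcases lt_or_ge v (ρ / 2) with hvρ | hvρ
    · have h1 : (v + δ) / ρ < 1 := by rw [div_lt_one hρ0]; linarith
      have h2 : ((C.filter q).card : ℝ) < 2 := by linarith
      have h3 : (C.filter q).card < 2 := by exact_mod_cast h2
      have h4 : ((C.filter q).card : ℝ) ≤ 1 := by exact_mod_cast (by omega)
      have : 0 ≤ 8 * (1 + 2 * 4 ^ e) * (C.card : ℝ) * (v / L) ^ s := by positivity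
      linarith
    · have hvδ : v + δ ≤ 2 * v := by linarith
      refine spread_count_bound hx hL hs0 hs1 hP1 hcard hv hP3 hP4 ?_ ?_ ?_
      · exact_mod_cast Finset.card_filter_le _ _
      · refine hsepcard.trans ?_
        have : (v + δ) / ρ = (v + δ) * (4 * x) ^ (2 * e) := by rw [hρ]; field_simp
        rw [this]; gcongr
      · refine (card_filter_primePowFractions_le (e := e) (P := P) q (t := t - δ) (v := v + δ)
          (by linarith) fun c hc hqc => ?_).trans ?_
        · obtain ⟨h3, h4⟩ := hq c hc hqc
          exact ⟨h3, by linarith⟩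
        · gcongr
  · have h1 : δ ^ s * 4 ^ (s * τ) = x ^ (-(s * τ)) := by
      rw [hδ, ← Real.rpow_mul h4x.le, show -τ * s = -(s * τ) by ring,
        Real.mul_rpow (by norm_num) hx0.le, mul_right_comm, ← Real.rpow_add (by norm_num)]
      simp
    have h2 : x ^ (e + 1 - ε - s * τ) = x ^ (1 - ε) * x ^ e * x ^ (-(s * τ)) := by
      rw [← Real.rpow_natCast, ← Real.rpow_add hx0, ← Real.rpow_add hx0]
      congr 1; ring
    have hLs : L = L ^ (1 - s) * L ^ s := by rw [← Real.rpow_add hL]; simp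
    have h4 : (0 : ℝ) < 4 ^ (s * τ) := by positivity
    have h3 : 32 ≤ x ^ (1 - ε) * x ^ e * δ ^ s * L ^ (1 - s) := by
      rw [h2, ← h1] at hP5
      refine le_of_mul_le_mul_right (hP5.trans_eq ?_) h4
      ring
    calc 4 * L ^ s = 32 * (L ^ s / 8) := by ring
      _ ≤ x ^ (1 - ε) * x ^ e * δ ^ s * L ^ (1 - s) * (L ^ s / 8) := by gcongr
      _ = x ^ (1 - ε) * (L ^ (1 - s) * L ^ s * x ^ e / 8) * δ ^ s := by ring
      _ = x ^ (1 - ε) * (L * x ^ e / 8) * δ ^ s := by rw [← hLs]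
      _ ≤ (primesBlock P).card * (L * x ^ e / 8) * δ ^ s := by gcongr
      _ ≤ _ := by gcongr

/-! ### Part: discrepancy and exponential sums. -/

theorem ncard_mem_Ioo_eq (u : ℕ → ℝ) (N : ℕ) (a b : ℝ) :
    {n : ℕ | 1 ≤ n ∧ n ≤ N ∧ u n ∈ Ioo a b}.ncard =
      ((Finset.Icc 1 N).filter fun n => a < u n ∧ u n < b).card := by
  rw [← Set.ncard_coe_finset]
  congr 1
  ext n
  simp [and_assoc]

theorem abs_card_sub_le_discrepancy (u : ℕ → ℝ) (N : ℕ) {a b : ℝ} (ha : 0 ≤ a) (hab : a < b)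
    (hb : b ≤ 1) :
    |(((Finset.Icc 1 N).filter fun n => a < u n ∧ u n < b).card : ℝ) - (b - a) * N| ≤
      discrepancy u N := by
  refine le_csSup (bddAbove_countingError u N) ⟨a, b, ha, hab, hb, ?_⟩
  rw [countingError, ncard_mem_Ioo_eq]

/-- Half-open initial intervals cost at most a factor two. -/
theorem abs_card_lt_sub_le_two_mul_discrepancy {u : ℕ → ℝ} (hu : ∀ n, u n ∈ Ico (0 : ℝ) 1) (N : ℕ)
    {t : ℝ} (ht0 : 0 < t) (ht1 : t ≤ 1) :
    |(((Finset.Icc 1 N).filter fun n => u n < t).card : ℝ) - t * N| ≤ 2 * discrepancy u N := by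
  have h1 := abs_card_sub_le_discrepancy u N le_rfl zero_lt_one le_rfl
  have h2 := abs_card_sub_le_discrepancy u N le_rfl ht0 ht1
  -- Points equal to `0` lie in no admissible open interval. Their number is the deficit of `(0,
  -- 1)`, hence at most the discrepancy.
  have h3 : ((Finset.Icc 1 N).filter fun n => u n = 0).card +
      ((Finset.Icc 1 N).filter fun n => 0 < u n ∧ u n < 1).card = N := by
    rw [← Finset.card_union_of_disjoint, ← Finset.filter_or]
    · rw [Finset.filter_true_of_mem, Nat.card_Icc, Nat.add_sub_cancel]
      intro n _
      rcases (hu n).1.eq_or_lt with h | h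
      · exact Or.inl h.symm
      · exact Or.inr ⟨h, (hu n).2⟩
    · rw [Finset.disjoint_filter]
      intro n _ h h'
      linarith [h'.1]
  have h4 : ((Finset.Icc 1 N).filter fun n => u n = 0).card +
      ((Finset.Icc 1 N).filter fun n => 0 < u n ∧ u n < t).card =
        ((Finset.Icc 1 N).filter fun n => u n < t).card := by
    rw [← Finset.card_union_of_disjoint, ← Finset.filter_or]
    · congr 1
      refine Finset.filter_congr fun n _ => ⟨?_, fun h => ?_⟩
      · rintro (h | h)
        · rw [h]; exact ht0
        · exact h.2
      · rcases (hu n).1.eq_or_lt with h' | h'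
        · exact Or.inl h'.symm
        · exact Or.inr ⟨h', h⟩
    · rw [Finset.disjoint_filter]
      intro n _ h h'
      linarith [h'.1]
  have h3' : (((Finset.Icc 1 N).filter fun n => u n = 0).card : ℝ) +
      ((Finset.Icc 1 N).filter fun n => 0 < u n ∧ u n < 1).card = N := by exact_mod_cast h3
  rw [← h4]
  push_cast
  rw [abs_le] at *
  constructor <;> linarith [h1.1, h1.2, h2.1, h2.2]

/-- Representation of `exp (2πiv)` by the sawtooth kernel. -/
theorem integral_sawtooth_mul_exp {v : ℝ} (hv : v ∈ Ico (0 : ℝ) 1) :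
    IntervalIntegrable (fun t : ℝ => ((t : ℂ) - if v < t then 1 else 0) *
      (2 * Real.pi * Complex.I * Complex.exp (2 * Real.pi * Complex.I * t)))
      MeasureTheory.volume 0 1 ∧
    ∫ t in (0 : ℝ)..1, ((t : ℂ) - if v < t then 1 else 0) *
      (2 * Real.pi * Complex.I * Complex.exp (2 * Real.pi * Complex.I * t)) =
      Complex.exp (2 * Real.pi * Complex.I * v) := by
  set w : ℂ := 2 * Real.pi * Complex.I with hw
  have hw0 : w ≠ 0 := Complex.two_pi_I_ne_zero
  -- Integration by parts, used with `κ = 0` before the jump at `v` and `κ = 1` after it.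
  have hprim : ∀ (κ : ℂ) (a b : ℝ), IntervalIntegrable
        (fun t : ℝ => ((t : ℂ) - κ) * (w * Complex.exp (w * t))) MeasureTheory.volume a b ∧
      ∫ t in a..b, ((t : ℂ) - κ) * (w * Complex.exp (w * t)) =
      ((b - κ) * Complex.exp (w * b) - Complex.exp (w * b) / w) -
        ((a - κ) * Complex.exp (w * a) - Complex.exp (w * a) / w) := by
    intro κ a b
    have hc : IntervalIntegrable (fun t : ℝ => ((t : ℂ) - κ) * (w * Complex.exp (w * t)))
        MeasureTheory.volume a b := by
      apply Continuous.intervalIntegrable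
      fun_prop
    refine ⟨hc, ?_⟩
    refine intervalIntegral.integral_eq_sub_of_hasDerivAt
      (f := fun t : ℝ => ((t : ℂ) - κ) * Complex.exp (w * t) - Complex.exp (w * t) / w)
      (fun t _ => ?_) hc
    have h0 : HasDerivAt (fun t : ℝ => (t : ℂ)) 1 t := Complex.ofRealCLM.hasDerivAt
    have h1 : HasDerivAt (fun t : ℝ => Complex.exp (w * t)) (Complex.exp (w * t) * (w * 1)) t :=
      (h0.const_mul w).cexp
    exact (((h0.sub_const κ).mul h1).sub (h1.div_const w)).congr_deriv (by field_simp; ring)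
  have hcongr1 : ∀ t ∈ Set.uIoc 0 v, ((t : ℂ) - 0) * (w * Complex.exp (w * t)) =
      ((t : ℂ) - if v < t then 1 else 0) * (w * Complex.exp (w * t)) := by
    intro t ht
    rw [uIoc_of_le hv.1] at ht
    rw [if_neg (not_lt.mpr ht.2)]
  have hcongr2 : ∀ t ∈ Set.uIoc v 1, ((t : ℂ) - 1) * (w * Complex.exp (w * t)) =
      ((t : ℂ) - if v < t then 1 else 0) * (w * Complex.exp (w * t)) := by
    intro t ht
    rw [uIoc_of_le hv.2.le] at ht
    rw [if_pos ht.1]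
  obtain ⟨i1, e1⟩ := hprim 0 0 v
  obtain ⟨i2, e2⟩ := hprim 1 v 1
  have j1 := i1.congr hcongr1
  have j2 := i2.congr hcongr2
  refine ⟨j1.trans j2, ?_⟩
  rw [← intervalIntegral.integral_add_adjacent_intervals j1 j2,
    ← intervalIntegral.integral_congr_ae (Filter.Eventually.of_forall hcongr1),
    ← intervalIntegral.integral_congr_ae (Filter.Eventually.of_forall hcongr2), e1, e2]
  have hexp : Complex.exp w = 1 := Complex.exp_two_pi_mul_I
  simp [hexp]
  ring

/-- Koksma's inequality for the exponential function. -/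
theorem norm_sum_exp_le_discrepancy {u : ℕ → ℝ} (hu : ∀ n, u n ∈ Ico (0 : ℝ) 1) (N : ℕ) :
    ‖∑ n ∈ Finset.Icc 1 N, Complex.exp (2 * Real.pi * Complex.I * u n)‖ ≤
      4 * Real.pi * discrepancy u N := by
  have hsum : ∑ n ∈ Finset.Icc 1 N, Complex.exp (2 * Real.pi * Complex.I * u n) =
      ∫ t in (0 : ℝ)..1, ∑ n ∈ Finset.Icc 1 N, ((t : ℂ) - if u n < t then 1 else 0) *
        (2 * Real.pi * Complex.I * Complex.exp (2 * Real.pi * Complex.I * t)) := by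
    rw [intervalIntegral.integral_finsetSum fun n _ => (integral_sawtooth_mul_exp (hu n)).1]
    exact Finset.sum_congr rfl fun n _ => (integral_sawtooth_mul_exp (hu n)).2.symm
  rw [hsum]
  have hbound : ∀ t ∈ Set.uIoc (0 : ℝ) 1, ‖∑ n ∈ Finset.Icc 1 N,
      ((t : ℂ) - if u n < t then 1 else 0) *
        (2 * Real.pi * Complex.I * Complex.exp (2 * Real.pi * Complex.I * t))‖ ≤
      2 * discrepancy u N * (2 * Real.pi) := by
    intro t ht
    rw [uIoc_of_le zero_le_one] at ht
    rw [← Finset.sum_mul, norm_mul]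
    have h1 : ‖2 * (Real.pi : ℂ) * Complex.I * Complex.exp (2 * Real.pi * Complex.I * t)‖ =
        2 * Real.pi := by
      rw [norm_mul, show 2 * (Real.pi : ℂ) * Complex.I * t = ((2 * Real.pi * t : ℝ) : ℂ) * Complex.I
        by push_cast; ring, Complex.norm_exp_ofReal_mul_I]
      simp [abs_of_pos Real.pi_pos]
    have h2 : ∑ n ∈ Finset.Icc 1 N, ((t : ℂ) - if u n < t then 1 else 0) =
        ((t * N - ((Finset.Icc 1 N).filter fun n => u n < t).card : ℝ) : ℂ) := by
      rw [Finset.sum_sub_distrib, Finset.sum_boole]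
      simp [mul_comm]
    rw [h1, h2, Complex.norm_real, Real.norm_eq_abs, abs_sub_comm]
    exact mul_le_mul_of_nonneg_right (abs_card_lt_sub_le_two_mul_discrepancy hu N ht.1 ht.2)
      (by positivity)
  refine (intervalIntegral.norm_integral_le_of_norm_le_const hbound).trans (le_of_eq ?_)
  rw [sub_zero, abs_one]; ring

theorem exp_two_pi_mul_I_mul_fract (y : ℝ) :
    Complex.exp (2 * Real.pi * Complex.I * (Int.fract y : ℝ)) =
      Complex.exp (2 * Real.pi * Complex.I * y) := by
  rw [Int.fract, Complex.ofReal_sub, mul_sub, Complex.exp_sub, Complex.ofReal_intCast,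
    mul_comm _ (⌊y⌋ : ℂ), Complex.exp_int_mul_two_pi_mul_I, div_one]

theorem norm_exp_sub_exp_le (y z : ℝ) :
    ‖Complex.exp (2 * Real.pi * Complex.I * y) - Complex.exp (2 * Real.pi * Complex.I * z)‖ ≤
      2 * Real.pi * |y - z| := by
  have h : Complex.exp (2 * Real.pi * Complex.I * y) - Complex.exp (2 * Real.pi * Complex.I * z) =
      Complex.exp ((2 * Real.pi * z : ℝ) * Complex.I) *
        (Complex.exp (Complex.I * (2 * Real.pi * (y - z) : ℝ)) - 1) := by
    rw [mul_sub, ← Complex.exp_add, mul_one]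
    congr 2 <;> push_cast <;> ring
  rw [h, norm_mul, Complex.norm_exp_ofReal_mul_I, one_mul]
  refine (Real.norm_exp_I_mul_ofReal_sub_one_le).trans (le_of_eq ?_)
  rw [Real.norm_eq_abs, abs_mul, abs_of_pos (by positivity)]

/-! ### Part: large discrepancy near rationals. -/

/-- The absolute value of the quadratic Gauss sum modulo an odd prime. -/
theorem norm_sum_stdAddChar_mul_sq {p : ℕ} [Fact p.Prime] (hp : p ≠ 2) {a : ZMod p} (ha : a ≠ 0) :
    ‖∑ x : ZMod p, ZMod.stdAddChar (a * x ^ 2)‖ = √p := by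
  have h2 : (2 : ZMod p) ≠ 0 := by
    have := Ring.two_ne_zero (R := ZMod p) (by rwa [ZMod.ringChar_zmod_n])
    exact this
  have key : (∑ x : ZMod p, ZMod.stdAddChar (a * x ^ 2)) *
      (starRingEnd ℂ) (∑ x : ZMod p, ZMod.stdAddChar (a * x ^ 2)) = p := by
    rw [map_sum, Finset.mul_sum]
    -- Substituting `x = h + y` makes the phase difference linear in `y`; summing over `y` then
    -- leaves only `h = 0`, as `2 * a` is invertible.
    have h3 : ∀ y : ZMod p, (∑ x : ZMod p, ZMod.stdAddChar (a * x ^ 2)) *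
        (starRingEnd ℂ) (ZMod.stdAddChar (a * y ^ 2)) =
        ∑ h : ZMod p, ZMod.stdAddChar (a * h ^ 2) * ZMod.stdAddChar (y * (2 * a * h)) := by
      intro y
      rw [← AddChar.map_neg_eq_conj, Finset.sum_mul, ← Equiv.sum_comp (Equiv.addRight y)]
      refine Finset.sum_congr rfl fun h _ => ?_
      rw [← AddChar.map_add_eq_mul, ← AddChar.map_add_eq_mul]
      congr 1
      simp only [Equiv.coe_addRight]
      ring
    rw [Finset.sum_congr rfl fun y _ => h3 y, Finset.sum_comm]
    have h4 : ∀ h : ZMod p, ∑ y : ZMod p, ZMod.stdAddChar (a * h ^ 2) *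
        ZMod.stdAddChar (y * (2 * a * h)) = if h = 0 then (p : ℂ) else 0 := by
      intro h
      rw [← Finset.mul_sum, AddChar.sum_mulShift _ (ZMod.isPrimitive_stdAddChar p)]
      by_cases hh : h = 0
      · simp [hh, ZMod.card]
      · simp [hh, h2, ha]
    rw [Finset.sum_congr rfl fun h _ => h4 h]
    simp
  rw [Complex.mul_conj, Complex.normSq_eq_norm_sq] at key
  rw [← Real.sqrt_sq (norm_nonneg _)]
  congr 1
  exact_mod_cast key

theorem sum_Icc_natCast_zmod {p : ℕ} [NeZero p] (g : ZMod p → ℂ) (k : ℕ) :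
    ∑ n ∈ Finset.Icc 1 (p * k), g (n : ZMod p) = k * ∑ x, g x := by
  have hblock : ∑ i ∈ Finset.range p, g ((i : ZMod p) + 1) = ∑ x, g x := by
    rw [← Equiv.sum_comp (Equiv.addRight (1 : ZMod p))]
    refine Finset.sum_nbij' (fun i => (i : ZMod p)) (fun x => x.val) (by simp) ?_ ?_ ?_ ?_
    · intro x _; simpa using ZMod.val_lt x
    · intro i hi; simpa using ZMod.val_cast_of_lt (by simpa using hi)
    · intro x _; simp
    · intro i _; simp
  have hrange : ∀ k : ℕ, ∑ n ∈ Finset.range (p * k), g ((n : ZMod p) + 1) = k * ∑ x, g x := by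
    intro k
    induction k with
    | zero => simp
    | succ k ih =>
      rw [mul_add, mul_one, Finset.sum_range_add, ih]
      simp only [Nat.cast_add, Nat.cast_mul, CharP.cast_eq_zero, zero_mul, zero_add]
      rw [hblock]; push_cast; ring
  rw [← hrange k, Finset.range_eq_Ico, ← Finset.Ico_succ_right_eq_Icc]
  have := Finset.sum_Ico_add' (fun n : ℕ => g (n : ZMod p)) 0 (p * k) 1
  simpa using this.symm

/-- A quadratic Weyl sum close to a fraction with odd prime denominator is large. -/
theorem le_discrepancy_sq_near_fraction {p a k : ℕ} (hp : p.Prime) (hp2 : p ≠ 2) (ha : ¬ p ∣ a)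
    {x : ℝ} (hx : (a : ℝ) / p ≤ x) :
    k * √p - 2 * Real.pi * (x - a / p) * ((p * k : ℕ) : ℝ) ^ 3 ≤
      4 * Real.pi * monomialDiscrepancy 2 x (p * k) := by
  have : Fact p.Prime := ⟨hp⟩
  set N := p * k with hN
  have hp0 : (p : ℝ) ≠ 0 := by exact_mod_cast hp.ne_zero
  set S : ℂ := ∑ n ∈ Finset.Icc 1 N, Complex.exp (2 * Real.pi * Complex.I * (x * n ^ 2 : ℝ)) with hS
  set S' : ℂ := ∑ n ∈ Finset.Icc 1 N,
    Complex.exp (2 * Real.pi * Complex.I * ((a : ℝ) / p * n ^ 2 : ℝ)) with hS'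
  have h1 : ‖S‖ ≤ 4 * Real.pi * monomialDiscrepancy 2 x N := by
    have := norm_sum_exp_le_discrepancy (u := fun n : ℕ => Int.fract (x * (n : ℝ) ^ 2))
      (fun n => ⟨Int.fract_nonneg _, Int.fract_lt_one _⟩) N
    simp only [exp_two_pi_mul_I_mul_fract] at this
    exact this
  have h2 : ‖S'‖ = k * √p := by
    have h3 : S' = ∑ n ∈ Finset.Icc 1 (p * k),
        (fun z : ZMod p => ZMod.stdAddChar ((a : ZMod p) * z ^ 2)) (n : ZMod p) := by
      refine Finset.sum_congr rfl fun n _ => ?_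
      have : (a : ZMod p) * (n : ZMod p) ^ 2 = (((a * n ^ 2 : ℕ) : ℤ) : ZMod p) := by push_cast; ring
      simp only
      rw [this, ZMod.stdAddChar_coe]
      congr 1; push_cast; ring
    rw [h3, sum_Icc_natCast_zmod (fun z : ZMod p => ZMod.stdAddChar ((a : ZMod p) * z ^ 2)), norm_mul, norm_sum_stdAddChar_mul_sq hp2, Complex.norm_natCast]
    rwa [Ne, ZMod.natCast_eq_zero_iff]
  have h3 : ‖S - S'‖ ≤ 2 * Real.pi * (x - a / p) * (N : ℝ) ^ 3 := by
    rw [hS, hS', ← Finset.sum_sub_distrib]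
    calc _ ≤ ∑ n ∈ Finset.Icc 1 N, 2 * Real.pi * (x - a / p) * (N : ℝ) ^ 2 := by
          refine norm_sum_le_of_le _ fun n hn => (norm_exp_sub_exp_le _ _).trans ?_
          have hnN : (n : ℝ) ≤ N := by exact_mod_cast (Finset.mem_Icc.mp hn).2
          have hx0 : 0 ≤ x - a / p := by linarith
          rw [← sub_mul, abs_of_nonneg (by positivity), ← mul_assoc]
          gcongr
      _ = _ := by
          rw [Finset.sum_const, Nat.card_Icc, Nat.add_sub_cancel, nsmul_eq_mul]; ring
  have h4 : ‖S'‖ ≤ ‖S‖ + ‖S - S'‖ := by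
    rw [norm_sub_rev]
    simpa using norm_add_le S (S' - S)
  linarith

/-- If `x` lies just to the right of `a / p ^ d`, then the multiples of `p` contribute many
fractional parts near zero. -/
theorem le_discrepancy_near_primePow_fraction {d p a N : ℕ} (hp : 0 < p) {x t : ℝ}
    (ht0 : 0 < t) (ht1 : t ≤ 1) (hx : (a : ℝ) / (p : ℝ) ^ d ≤ x)
    (hxt : (x - a / (p : ℝ) ^ d) * (N : ℝ) ^ d < t) :
    (N : ℝ) / p - 1 - t * N ≤ 2 * monomialDiscrepancy d x N := by
  have hp0 : (0 : ℝ) < p := by exact_mod_cast hp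
  have h1 := abs_card_lt_sub_le_two_mul_discrepancy
    (u := fun n : ℕ => Int.fract (x * (n : ℝ) ^ d))
    (fun n => ⟨Int.fract_nonneg _, Int.fract_lt_one _⟩) N ht0 ht1
  have h2 : N / p ≤ ((Finset.Icc 1 N).filter fun n : ℕ => Int.fract (x * (n : ℝ) ^ d) < t).card := by
    have h3 : ((Finset.Icc 1 (N / p)).image fun m => p * m) ⊆
        (Finset.Icc 1 N).filter fun n : ℕ => Int.fract (x * (n : ℝ) ^ d) < t := by
      intro n hn
      obtain ⟨m, hm, rfl⟩ := Finset.mem_image.mp hn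
      obtain ⟨hm1, hm2⟩ := Finset.mem_Icc.mp hm
      have hmN : p * m ≤ N := by
        rw [mul_comm]; exact (Nat.le_div_iff_mul_le hp).mp hm2
      have hmN' : ((p * m : ℕ) : ℝ) ≤ N := by exact_mod_cast hmN
      refine Finset.mem_filter.mpr ⟨Finset.mem_Icc.mpr ⟨Nat.mul_pos hp hm1, hmN⟩, ?_⟩
      have hy0 : 0 ≤ x - a / (p : ℝ) ^ d := by linarith
      -- At a multiple of `p` the rational part of the phase is the integer `a * m ^ d`.
      have hsplit : x * ((p * m : ℕ) : ℝ) ^ d =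
          (x - a / (p : ℝ) ^ d) * ((p * m : ℕ) : ℝ) ^ d + ((a * m ^ d : ℕ) : ℝ) := by
        push_cast
        rw [mul_pow]
        field_simp
        ring
      have hlt : (x - a / (p : ℝ) ^ d) * ((p * m : ℕ) : ℝ) ^ d < t :=
        lt_of_le_of_lt (by gcongr) hxt
      rw [hsplit, Int.fract_add_natCast, Int.fract_eq_self.mpr ⟨by positivity, by linarith⟩]
      exact hlt
    have h4 := Finset.card_le_card h3
    rwa [Finset.card_image_of_injective _ fun m m' h => Nat.eq_of_mul_eq_mul_left hp h,
      Nat.card_Icc, Nat.add_sub_cancel] at h4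
  have h5 : (N : ℝ) / p - 1 ≤ ((N / p : ℕ) : ℝ) := by
    have : (N : ℝ) / p < ((N / p : ℕ) : ℝ) + 1 := by
      rw [div_lt_iff₀ hp0]
      exact_mod_cast (by rw [mul_comm]; exact Nat.lt_mul_div_succ N hp : N < (N / p + 1) * p)
    linarith
  have h6 : ((N / p : ℕ) : ℝ) ≤
      (((Finset.Icc 1 N).filter fun n : ℕ => Int.fract (x * (n : ℝ) ^ d) < t).card : ℝ) := by
    exact_mod_cast h2
  have h7 := (abs_le.mp h1).2
  rw [monomialDiscrepancy]
  linarith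

/-! ### Part: choice of parameters and conclusion. -/

theorem mem_largeDiscrepancySet_of_forall_exists {α : ℝ} {d : ℕ} {x : ℝ} (hx : x ∈ Ico (0 : ℝ) 1)
    (h : ∀ k : ℕ, ∃ N ≥ k, (N : ℝ) ^ α ≤ monomialDiscrepancy d x N) :
    x ∈ largeDiscrepancySet α d :=
  ⟨hx, Set.infinite_of_forall_exists_gt fun k =>
    let ⟨N, hN, h'⟩ := h (k + 1)
    ⟨N, h', hN⟩⟩

theorem largeDiscrepancySet_anti {α β : ℝ} (h : α ≤ β) (d : ℕ) :
    largeDiscrepancySet β d ⊆ largeDiscrepancySet α d := by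
  rintro x ⟨hx, hinf⟩
  refine mem_largeDiscrepancySet_of_forall_exists hx fun k => ?_
  obtain ⟨N, hN, hk⟩ := hinf.exists_gt k
  refine ⟨N, hk.le, le_trans ?_ hN⟩
  exact Real.rpow_le_rpow_of_exponent_le (by exact_mod_cast (by omega : 1 ≤ N)) h

theorem ofReal_le_of_forall_pos_lt {v : ℝ} {D : ENNReal}
    (h : ∀ s : ℝ, 0 < s → s < v → ENNReal.ofReal s ≤ D) : ENNReal.ofReal v ≤ D := by
  by_contra hlt
  obtain ⟨c, hc1, hc2⟩ := exists_between (not_le.mp hlt)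
  have hc : c ≠ ⊤ := (hc2.trans_le le_top).ne
  have h0 : 0 < c.toReal := ENNReal.toReal_pos (ne_bot_of_gt hc1) hc
  have hv : c.toReal < v := by
    rw [← ENNReal.ofReal_toReal hc] at hc2
    exact (ENNReal.ofReal_lt_ofReal_iff_of_nonneg h0.le).mp hc2
  have := h _ h0 hv
  rw [ENNReal.ofReal_toReal hc] at this
  exact absurd hc1 (not_lt.mpr this)

theorem exists_large_sq_discrepancy {α τ : ℝ} (hα : 1 / 2 ≤ α) (hα1 : α < 1)
    (hτ : (3 - α) / (2 * (1 - α)) < τ) (k₀ : ℕ) :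
    ∃ p₀ : ℕ, ∀ p ≥ p₀, p.Prime → ∀ a : ℕ, ¬ p ∣ a → ∀ x : ℝ,
      (a : ℝ) / (p : ℝ) ^ 1 ≤ x → x ≤ (a : ℝ) / (p : ℝ) ^ 1 + (p : ℝ) ^ (-τ) →
        ∃ N ≥ k₀, (N : ℝ) ^ α ≤ monomialDiscrepancy 2 x N := by
  have hα' : 0 < 1 - α := by linarith
  set γ : ℝ := 1 / (2 * (1 - α)) with hγ
  have hγ0 : 0 < γ := by positivity
  have hγ1 : 1 ≤ γ := by rw [hγ, le_div_iff₀ (by positivity)]; linarith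
  have hγτ : γ * (3 - α) < τ := by rw [hγ]; rwa [one_div_mul_eq_div]
  obtain ⟨p₁, hp₁⟩ := Filter.eventually_atTop.mp
    (eventually_le_natCast_rpow (γ := τ - γ * (3 - α)) (by linarith) (8 * 400 ^ (3 * γ)))
  refine ⟨max (max p₁ 3) k₀, fun p hp hpp a ha x hx hx' => ?_⟩
  have hp1 : p₁ ≤ p := (le_max_left _ _).trans ((le_max_left _ _).trans hp)
  have hp3 : 3 ≤ p := (le_max_right _ _).trans ((le_max_left _ _).trans hp)
  have hpk : k₀ ≤ p := (le_max_right _ _).trans hp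
  rw [pow_one] at hx hx'
  have hbig := hp₁ p hp1
  have hp0 : (0 : ℝ) < p := by exact_mod_cast hpp.pos
  have hp1' : (1 : ℝ) ≤ p := by exact_mod_cast hpp.one_le
  -- Chosen so that `y ^ (1 - α) = 20 * √p`. The `20` exceeds `6 * π`: `4 * π` from Koksma and `2 *
  -- π` from the perturbation.
  set y : ℝ := (400 * p) ^ γ with hy
  have hy0 : 0 < y := by positivity
  have hpy : (p : ℝ) ≤ y := calc
    (p : ℝ) ≤ 400 * p := by linarith
    _ = (400 * p : ℝ) ^ (1 : ℝ) := (Real.rpow_one _).symm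
    _ ≤ _ := Real.rpow_le_rpow_of_exponent_le (by linarith) hγ1
  -- Rounding up to whole periods leaves `p * k` between `y` and `2 * y`, because `p ≤ y`.
  set k : ℕ := ⌈y / p⌉₊ with hk
  have hk1 : y / p ≤ k := Nat.le_ceil _
  have hk2 : (k : ℝ) < y / p + 1 := Nat.ceil_lt_add_one (by positivity)
  have hkpos : 0 < k := Nat.ceil_pos.mpr (by positivity)
  have hNr : ((p * k : ℕ) : ℝ) = p * k := by push_cast; ring
  have hyN : y ≤ ((p * k : ℕ) : ℝ) := by
    rw [hNr]; rw [div_le_iff₀ hp0] at hk1; linarith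
  have hN2 : ((p * k : ℕ) : ℝ) ≤ 2 * y := by
    rw [hNr]
    have : (p : ℝ) * k ≤ p * (y / p + 1) := by gcongr
    rw [mul_add, mul_div_cancel₀ _ hp0.ne'] at this
    linarith
  refine ⟨p * k, hpk.trans (Nat.le_mul_of_pos_right p hkpos), ?_⟩
  have hdisc := le_discrepancy_sq_near_fraction (k := k) hpp (by omega) ha hx
  set N : ℕ := p * k with hN
  have hN0 : (0 : ℝ) < N := hy0.trans_le hyN
  have hmain : 20 * (N : ℝ) ^ α ≤ k * √p := by
    have h1 : 20 * √(p : ℝ) ≤ (N : ℝ) ^ (1 - α) := calc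
      20 * √(p : ℝ) = √(400 * p) := by
        rw [Real.sqrt_mul (by norm_num), show (400 : ℝ) = 20 ^ 2 by norm_num,
          Real.sqrt_sq (by norm_num)]
      _ = y ^ (1 - α) := by
        rw [hy, ← Real.rpow_mul (by positivity), Real.sqrt_eq_rpow]
        congr 1; rw [hγ]; field_simp
      _ ≤ _ := Real.rpow_le_rpow hy0.le hyN hα'.le
    have h2 : (N : ℝ) = N ^ α * N ^ (1 - α) := by rw [← Real.rpow_add hN0]; simp
    have h3 : √(p : ℝ) * √(p : ℝ) = p := Real.mul_self_sqrt hp0.le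
    have hsp : 0 < √(p : ℝ) := Real.sqrt_pos.mpr hp0
    have h4 : (N : ℝ) ^ α * (20 * √(p : ℝ)) ≤ k * √p * √p := by
      calc (N : ℝ) ^ α * (20 * √(p : ℝ)) ≤ N ^ α * N ^ (1 - α) := by gcongr
        _ = p * k := by rw [← h2, hNr]
        _ = k * √p * √p := by rw [mul_assoc, h3, mul_comm]
    exact le_of_mul_le_mul_right (by linarith) hsp
  have herr : (x - a / p) * (N : ℝ) ^ 3 ≤ (N : ℝ) ^ α := by
    have h1 : x - a / p ≤ (p : ℝ) ^ (-τ) := by linarith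
    have h2 : y ^ (3 : ℕ) = 400 ^ (3 * γ) * (p : ℝ) ^ (3 * γ) := by
      rw [← Real.mul_rpow (by norm_num) hp0.le, hy, ← Real.rpow_mul_natCast (by positivity),
        mul_comm γ]
      norm_num
    have h3 : (p : ℝ) ^ (γ * α) ≤ (N : ℝ) ^ α := calc
      (p : ℝ) ^ (γ * α) ≤ (400 * p) ^ (γ * α) :=
        Real.rpow_le_rpow hp0.le (by linarith) (by positivity)
      _ = y ^ α := by rw [hy, ← Real.rpow_mul (by positivity)]
      _ ≤ _ := Real.rpow_le_rpow hy0.le hyN (by linarith)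
    calc (x - a / p) * (N : ℝ) ^ 3 ≤ (p : ℝ) ^ (-τ) * (2 * y) ^ 3 := by gcongr
      _ = (p : ℝ) ^ (-τ) * (8 * 400 ^ (3 * γ)) * (p : ℝ) ^ (3 * γ) := by
        rw [mul_pow, h2]; ring
      _ ≤ (p : ℝ) ^ (-τ) * (p : ℝ) ^ (τ - γ * (3 - α)) * (p : ℝ) ^ (3 * γ) := by gcongr
      _ = (p : ℝ) ^ (γ * α) := by
        rw [← Real.rpow_add hp0, ← Real.rpow_add hp0]; congr 1; ring
      _ ≤ _ := h3
  have hNα : 0 < (N : ℝ) ^ α := Real.rpow_pos_of_pos hN0 α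
  have hpi := Real.pi_lt_d2
  have hpi0 := Real.pi_pos
  have h5 : 4 * Real.pi * (N : ℝ) ^ α ≤ 4 * Real.pi * monomialDiscrepancy 2 x N := by
    refine le_trans ?_ hdisc
    have h6 : 2 * Real.pi * (x - a / p) * (N : ℝ) ^ 3 ≤ 2 * Real.pi * (N : ℝ) ^ α := by
      rw [mul_assoc]; gcongr
    have h7 : 6 * Real.pi * (N : ℝ) ^ α ≤ 20 * (N : ℝ) ^ α := by gcongr; linarith
    linarith
  exact le_of_mul_le_mul_left h5 (by positivity)

theorem exists_large_pow_discrepancy {d : ℕ} {α τ : ℝ} (hα0 : 0 < α) (hα1 : α < 1)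
    (hτ : (d + 1 - α) / (1 - α) < τ) (k₀ : ℕ) :
    ∃ p₀ : ℕ, ∀ p ≥ p₀, p.Prime → ∀ a : ℕ, ¬ p ∣ a → ∀ x : ℝ,
      (a : ℝ) / (p : ℝ) ^ d ≤ x → x ≤ (a : ℝ) / (p : ℝ) ^ d + (p : ℝ) ^ (-τ) →
        ∃ N ≥ k₀, (N : ℝ) ^ α ≤ monomialDiscrepancy d x N := by
  have hα' : 0 < 1 - α := by linarith
  set γ : ℝ := 1 / (1 - α) with hγ
  have hγ0 : 0 < γ := by positivity
  have hγ1 : 1 ≤ γ := by rw [hγ, le_div_iff₀ (by positivity)]; linarith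
  have hγτ : 1 + γ * d < τ := by
    have : 1 + γ * d = (d + 1 - α) / (1 - α) := by rw [hγ]; field_simp; ring
    linarith
  obtain ⟨p₁, hp₁⟩ := Filter.eventually_atTop.mp
    (eventually_le_natCast_rpow (γ := τ - (1 + γ * d)) (by linarith)
      (17 * 2 ^ d * 8 ^ (γ * d)))
  refine ⟨max p₁ k₀, fun p hp hpp a _ x hx hx' => ?_⟩
  have hpk : k₀ ≤ p := (le_max_right _ _).trans hp
  have hbig := hp₁ p ((le_max_left _ _).trans hp)
  have hp0 : (0 : ℝ) < p := by exact_mod_cast hpp.pos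
  have hp1' : (1 : ℝ) ≤ p := by exact_mod_cast hpp.one_le
  -- This gives `N / p ≥ 8 * N ^ α`, ample against the losses `1`, `t * N = N ^ α` and the factor
  -- `2` on the discrepancy.
  set y : ℝ := (8 * p) ^ γ with hy
  have hy0 : 0 < y := by positivity
  have hpy : (p : ℝ) ≤ y := calc
    (p : ℝ) ≤ 8 * p := by linarith
    _ = (8 * p : ℝ) ^ (1 : ℝ) := (Real.rpow_one _).symm
    _ ≤ _ := Real.rpow_le_rpow_of_exponent_le (by linarith) hγ1
  set N : ℕ := ⌈y⌉₊ with hN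
  have hyN : y ≤ N := Nat.le_ceil _
  have hN2 : (N : ℝ) ≤ 2 * y := by linarith [Nat.ceil_lt_add_one hy0.le]
  have hN0 : (0 : ℝ) < N := hy0.trans_le hyN
  have hN1 : (1 : ℝ) ≤ N := by linarith
  refine ⟨N, by exact_mod_cast (le_trans (by exact_mod_cast hpk) (hpy.trans hyN) : (k₀ : ℝ) ≤ N), ?_⟩
  have hyα : y ^ (1 - α) = 8 * p := by
    rw [hy, ← Real.rpow_mul (by positivity), hγ, one_div_mul_cancel hα'.ne', Real.rpow_one]
  have h8 : 8 * (p : ℝ) ≤ (N : ℝ) ^ (1 - α) := hyα ▸ Real.rpow_le_rpow hy0.le hyN hα'.le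
  have h16 : (N : ℝ) ^ (1 - α) ≤ 16 * p := calc
    (N : ℝ) ^ (1 - α) ≤ (2 * y) ^ (1 - α) := Real.rpow_le_rpow hN0.le hN2 hα'.le
    _ = 2 ^ (1 - α) * (8 * p) := by rw [Real.mul_rpow (by norm_num) hy0.le, hyα]
    _ ≤ 2 ^ (1 : ℝ) * (8 * p) := by
      gcongr
      · norm_num
      · linarith
    _ = 16 * p := by rw [Real.rpow_one]; ring
  set t : ℝ := (N : ℝ) ^ (α - 1) with ht
  have ht0 : 0 < t := Real.rpow_pos_of_pos hN0 _
  have ht1 : t ≤ 1 := Real.rpow_le_one_of_one_le_of_nonpos hN1 (by linarith)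
  have htN : t * (N : ℝ) ^ (1 - α) = 1 := by rw [ht, ← Real.rpow_add hN0]; simp
  have htα : t * N = (N : ℝ) ^ α := by
    rw [ht]
    nth_rewrite 2 [← Real.rpow_one (N : ℝ)]
    rw [← Real.rpow_add hN0]; congr 1; ring
  have hsmall : (x - a / (p : ℝ) ^ d) * (N : ℝ) ^ d < t := by
    have h1 : x - a / (p : ℝ) ^ d ≤ (p : ℝ) ^ (-τ) := by linarith
    have h2 : y ^ d = 8 ^ (γ * d) * (p : ℝ) ^ (γ * d) := by
      rw [← Real.mul_rpow (by norm_num) hp0.le, hy, ← Real.rpow_mul_natCast (by positivity)]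
    -- Since `1 / t = N ^ (1 - α) ≤ 16 * p`, the `17` supplies the strict inequality.
    have h3 : (x - a / (p : ℝ) ^ d) * (N : ℝ) ^ d * (17 * p) ≤ 1 := by
      calc (x - a / (p : ℝ) ^ d) * (N : ℝ) ^ d * (17 * p)
          ≤ (p : ℝ) ^ (-τ) * (2 * y) ^ d * (17 * p) := by gcongr
        _ = (p : ℝ) ^ (-τ) * (17 * 2 ^ d * 8 ^ (γ * d)) * ((p : ℝ) ^ (1 : ℝ) * (p : ℝ) ^ (γ * d)) := by
          rw [mul_pow, h2, Real.rpow_one]; ring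
        _ ≤ (p : ℝ) ^ (-τ) * (p : ℝ) ^ (τ - (1 + γ * d)) *
            ((p : ℝ) ^ (1 : ℝ) * (p : ℝ) ^ (γ * d)) := by gcongr
        _ = 1 := by
          rw [← Real.rpow_add hp0, ← Real.rpow_add hp0, ← Real.rpow_add hp0]
          ring_nf; exact Real.rpow_zero _
    have h4 : 1 < t * (17 * p) := by
      calc (1 : ℝ) = t * (N : ℝ) ^ (1 - α) := htN.symm
        _ ≤ t * (16 * p) := by gcongr
        _ < t * (17 * p) := by gcongr; norm_num
    exact lt_of_mul_lt_mul_right (h3.trans_lt h4) (by positivity)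
  have hdisc := le_discrepancy_near_primePow_fraction (N := N) hpp.pos ht0 ht1 hx hsmall
  have hNα1 : 1 ≤ (N : ℝ) ^ α := Real.one_le_rpow hN1 hα0.le
  have hNp : 8 * (N : ℝ) ^ α ≤ N / p := by
    rw [le_div_iff₀ hp0]
    calc 8 * (N : ℝ) ^ α * p = (N : ℝ) ^ α * (8 * p) := by ring
      _ ≤ (N : ℝ) ^ α * (N : ℝ) ^ (1 - α) := by gcongr
      _ = N := by rw [← Real.rpow_add hN0]; simp
  rw [htα] at hdisc
  linarith

theorem le_dimH_largeDiscrepancySet_two {α : ℝ} (hα : 1 / 2 ≤ α) (hα1 : α < 1) :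
    ENNReal.ofReal (4 * (1 - α) / (3 - α)) ≤ dimH (largeDiscrepancySet α 2) := by
  refine ofReal_le_of_forall_pos_lt fun s hs0 hs => ?_
  have h1 : 0 < 1 - α := by linarith
  have h3 : 0 < 3 - α := by linarith
  have hs' := hs
  rw [lt_div_iff₀ h3] at hs
  have hs1 : s < 1 := hs'.trans_le (by rw [div_le_one h3]; linarith)
  obtain ⟨τ, hτ1, hτ2⟩ : ∃ τ : ℝ, (3 - α) / (2 * (1 - α)) < τ ∧ τ < 2 / s :=
    exists_between (by rw [div_lt_div_iff₀ (by linarith) hs0]; linarith)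
  have hτ3 : 2 < τ := lt_of_le_of_lt (by rw [le_div_iff₀ (by linarith)]; linarith) hτ1
  rw [lt_div_iff₀ hs0] at hτ2
  exact le_dimH_of_near_primePow_fractions (e := 1) le_rfl hs0 hs1 (by push_cast; linarith)
    (by push_cast; linarith) (by push_cast; linarith) _
    (fun x hx h => mem_largeDiscrepancySet_of_forall_exists hx h)
    (exists_large_sq_discrepancy hα hα1 hτ1)

theorem le_dimH_largeDiscrepancySet {α : ℝ} {d : ℕ} (hd : 2 ≤ d) (hα0 : 0 < α)
    (hα : 1 - 1 / (d : ℝ) ≤ α) (hα1 : α < 1) :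
    ENNReal.ofReal ((d + 1) * (1 - α) / (d + 1 - α)) ≤ dimH (largeDiscrepancySet α d) := by
  refine ofReal_le_of_forall_pos_lt fun s hs0 hs => ?_
  have hd' : (2 : ℝ) ≤ d := by exact_mod_cast hd
  have hd0 : (0 : ℝ) < d := by linarith
  have h1 : 0 < 1 - α := by linarith
  have hdα : (1 - α) * d ≤ 1 := by
    have : 1 - α ≤ 1 / d := by linarith
    rwa [le_div_iff₀ hd0] at this
  have h3 : 0 < d + 1 - α := by linarith
  rw [lt_div_iff₀ h3] at hs
  -- For `α ≥ 1 - 1 / d` the target is at most its value at the threshold; the spacing condition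
  -- follows from this bound alone.
  have hsd : s * (d ^ 2 + 1) < d + 1 := by
    have e1 : s * (d + 1 - α) < (d + 1) * (1 - α) := hs
    have e2 : (1 - α) * (d ^ 2 + 1) ≤ d + 1 - α := by nlinarith
    have e3 : s * (1 - α) * (d ^ 2 + 1) ≤ s * (d + 1 - α) := by
      rw [mul_assoc]; gcongr
    have e4 : (1 - α) * (s * (d ^ 2 + 1)) < (1 - α) * (d + 1) := by linarith
    exact lt_of_mul_lt_mul_left e4 h1.le
  have hs1 : s < 1 := by
    by_contra h
    have : 1 * ((d : ℝ) ^ 2 + 1) ≤ s * (d ^ 2 + 1) := by gcongr; exact not_lt.mp h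
    nlinarith
  have hse : s * (2 * d - 1) < d := by
    have e1 : ((d : ℝ) + 1) * (2 * d - 1) ≤ d * (d ^ 2 + 1) := by nlinarith [sq_nonneg ((d : ℝ) - 1)]
    have e2 : (s * (2 * d - 1)) * (d ^ 2 + 1) < d * (d ^ 2 + 1) := by
      have : s * (d ^ 2 + 1) * (2 * d - 1) < (d + 1) * (2 * d - 1) := by
        gcongr; linarith
      linarith
    exact lt_of_mul_lt_mul_right e2 (by positivity)
  obtain ⟨τ, hτ1, hτ2⟩ : ∃ τ : ℝ, (d + 1 - α) / (1 - α) < τ ∧ τ < (d + 1) / s :=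
    exists_between (by rw [div_lt_div_iff₀ h1 hs0]; linarith)
  have hτ3 : 2 * d < τ := lt_of_le_of_lt (by rw [le_div_iff₀ h1]; nlinarith) hτ1
  rw [lt_div_iff₀ hs0] at hτ2
  exact le_dimH_of_near_primePow_fractions (e := d) (by omega) hs0 hs1 hse
    (by linarith) hτ3 _
    (fun x hx h => mem_largeDiscrepancySet_of_forall_exists hx h)
    (exists_large_pow_discrepancy hα0 hα1 hτ1)

theorem theorem1p12 (α : ℝ) (hα0 : 0 < α) (hα1 : α < 1) :
    ENNReal.ofReal (min (4 / 5 : ℝ) (4 * (1 - α) / (3 - α)))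
        ≤ dimH (largeDiscrepancySet α 2) ∧
    ∀ d : ℕ, 3 ≤ d →
      ENNReal.ofReal
          (min (((d : ℝ) + 1) / ((d : ℝ) ^ 2 + 1))
            (((d : ℝ) + 1) * (1 - α) / ((d : ℝ) + 1 - α)))
        ≤ dimH (largeDiscrepancySet α d) := by
  refine ⟨?_, fun d hd => ?_⟩
  · rcases le_total (1 / 2) α with h | h
    · exact (ENNReal.ofReal_le_ofReal (min_le_right _ _)).trans
        (le_dimH_largeDiscrepancySet_two h hα1)
    · refine (ENNReal.ofReal_le_ofReal (min_le_left _ _)).trans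
        (le_trans ?_ (dimH_mono (largeDiscrepancySet_anti h 2)))
      rw [show (4 / 5 : ℝ) = 4 * (1 - 1 / 2) / (3 - 1 / 2) by norm_num]
      exact le_dimH_largeDiscrepancySet_two le_rfl (by norm_num)
  · have hd' : (3 : ℝ) ≤ d := by exact_mod_cast hd
    have hinv : 1 / (d : ℝ) ≤ 1 / 3 := one_div_le_one_div_of_le (by norm_num) hd'
    have hinv0 : 0 < 1 / (d : ℝ) := by positivity
    rcases le_total (1 - 1 / (d : ℝ)) α with h | h
    · exact (ENNReal.ofReal_le_ofReal (min_le_right _ _)).trans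
        (le_dimH_largeDiscrepancySet (by omega) hα0 h hα1)
    · refine (ENNReal.ofReal_le_ofReal (min_le_left _ _)).trans
        (le_trans ?_ (dimH_mono (largeDiscrepancySet_anti h d)))
      have heq : ((d : ℝ) + 1) / ((d : ℝ) ^ 2 + 1) =
          (d + 1) * (1 - (1 - 1 / (d : ℝ))) / (d + 1 - (1 - 1 / (d : ℝ))) := by
        have hd0 : (d : ℝ) ≠ 0 := by positivity
        rw [show (d : ℝ) + 1 - (1 - 1 / d) = ((d : ℝ) ^ 2 + 1) / d by field_simp; ring,
          show ((d : ℝ) + 1) * (1 - (1 - 1 / d)) = (d + 1) / d by ring]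
        field_simp
      rw [heq]
      exact le_dimH_largeDiscrepancySet (by omega) (by linarith) le_rfl (by linarith)
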